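/- Let $e\in\{2,3,4\}$, $d\ge 1$ and $N=(d-1)(e-1)$. The vanishing cycles of $y^e+x^d$ are the join cycles $\delta_i^j$ ($1\le i\le e-1$, $1\le j\le d-1$), which form a basis of the first homology of a regular fibre; $i$ is the row and $j$ the column in the Dynkin diagram. Their intersection form $\langle\cdot,\cdot\rangle$ is the skew-symmetric form given by the intersection formula for join cycles: - $\langle\delta_i^j,\delta_i^{j'}\rangle=1$ if $|j-j'|=1$ and $j$ is odd; - $\langle\delta_i^j,\delta_{i'}^j\rangle=1$ if $|i-i'|=1$ and $i$ is odd; - $\langle\delta_{i'}^{j'},\delta_i^j\rangle=1$ if $|i-i'|=|j-j'|=1$ and $i,j$ are odd, $i',j'$ are even; - all pairings that do not follow from these by skew-symmetry are $0$. Let $\Psi_e$ be the $N\times N$ matrix whose entry in row $\delta$ and column $\delta'$ is $\langle\delta',\delta\rangle$, and let $M_e=I_N-\Psi_e$ be the monodromy matrix attached to this diagram by the Picard–Lefschetz formula $v\mapsto v-\sum_{\delta}\langle v,\delta\rangle\delta$, the sum being over all vanishing cycles. Let $K$ be a field of characteristic $0$ (for instance $\mathbb Q$ or $\mathbb R$),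 and let $\mathrm{Mon}(\delta_i^j)\subseteq K^N$ be the subspace spanned by the vectors $M_e^l\,\delta_i^j$, $0\le l\le N-1$. Write $r=\gcd(d,j)$. Then: 1. ($e=2$, every $d\ge1$.) The set of eigenvalues of $M_2$ is $\{1+2\sqrt{-1}\cos(k\pi/d) : 1\le k\le d-1\}$, and the vanishing cycles in $\mathrm{Mon}(\delta_1^j)$ are exactly the $\delta_1^l$ with $l=rn$, $n=1,\dots,\frac dr-1$. 2. ($e=3$.) If $d\le100$ and $3\nmid d$, then for $i=1,2$ the vanishing cycles in $\mathrm{Mon}(\delta_i^j)$ are exactly the $\delta_m^l$ with $m\in\{1,2\}$ and $l=rn$, $n=1,\dots,\frac dr-1$. If $3\mid d$, then $M_3$ has fewer than $2(d-1)$ distinct complex eigenvalues. 3. ($e=4$.) If $d\le100$ and $4\nmid d$, then for $i=1,3$ the vanishing cycles in $\mathrm{Mon}(\delta_i^j)$ are exactly the $\delta_m^l$ with $m\in\{1,2,3\}$ and $l=rn$, $n=1,\dots,\frac dr-1$, while those in $\mathrm{Mon}(\delta_2^j)$ are exactly the $\delta_2^l$ with $l=rn$, $n=1,\dots,\frac dr-1$.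 If $4\mid d$, then $M_4$ has fewer than $3(d-1)$ distinct complex eigenvalues. -/

import Mathlib

/-- The vanishing cycles `δ_i^j` of `y^e + x^d`: pairs `(i, j)` consisting of the row `i` with
`1 ≤ i < e` and the column `j` with `1 ≤ j < d` of the Dynkin diagram. They are a basis of the
first homology of a regular fibre. -/
abbrev VanCycle (e d : ℕ) : Type := ↥(Finset.Ico 1 e) × ↥(Finset.Ico 1 d)

/-- The row `i` of `δ_i^j`. -/
def VanCycle.row {e d : ℕ} (δ : VanCycle e d) : ℕ := δ.1

/-- The column `j` of `δ_i^j`. -/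
def VanCycle.col {e d : ℕ} (δ : VanCycle e d) : ℕ := δ.2

/-- Intersection number of the `0`-dimensional vanishing cycles at the positions `a` and `b` of the
`0`-dimensional Dynkin diagram of a polynomial in one variable with real critical points: the
diagram is a path, a `0`-cycle (a difference of two points) has self-intersection `2`, and
neighbours have intersection number `-1`. -/
def zeroIntersection (a b : ℕ) : ℤ :=
  if a = b then 2 else if a + 1 = b ∨ b + 1 = a then -1 else 0

/-- Index, in the enumeration by the distinguished system of paths, of the `0`-dimensional vanishing
cycle at position `k` in the `0`-dimensional Dynkin diagram
`σ_{l+1} - σ_1 - σ_{l+2} - σ_2 - σ_{l+3} - ⋯` of a polynomial of degree `n`, with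
`l = ⌊(n-1)/2⌋`. -/
def enumIndex (n k : ℕ) : ℕ := if Even k then k / 2 else (n - 1) / 2 + (k + 1) / 2

/-- The intersection number `⟨δ, δ'⟩` of two vanishing cycles, which are the join cycles
`δ = γ_p * σ_q` and `δ' = γ_p' * σ_q'`. -/
def intersectionNumber (e d : ℕ) (δ δ' : VanCycle e d) : ℤ :=
  let p : ℤ := enumIndex e δ.row
  let p' : ℤ := enumIndex e δ'.row
  let q : ℤ := enumIndex d δ.col
  let q' : ℤ := enumIndex d δ'.col
  if p = p' ∧ q ≠ q' then (q' - q).sign * zeroIntersection δ.col δ'.col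
  else if q = q' ∧ p ≠ p' then (p' - p).sign * zeroIntersection δ.row δ'.row
  else if 0 < (p' - p) * (q' - q) then
    (p' - p).sign * zeroIntersection δ.row δ'.row * zeroIntersection δ.col δ'.col
  else 0

/-- The matrix `Ψ_e`. The entry in row `δ` and column `δ'` is `⟨δ', δ⟩`, so that the column of `δ'`
holds the coordinates of `∑ δ, ⟨δ', δ⟩ δ`. -/
def intersectionMatrix (e d : ℕ) : Matrix (VanCycle e d) (VanCycle e d) ℤ :=
  Matrix.of fun δ δ' => intersectionNumber e d δ' δ

/-- The monodromy matrix `M_e = I - Ψ_e` attached to the Dynkin diagram of `y^e + x^d`, with entries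
in `K`: its action on column vectors is the Picard-Lefschetz formula `v ↦ v - ∑ δ, ⟨v, δ⟩ δ`, the
sum running over all vanishing cycles since there is only one critical value. -/
def monodromyMatrix (K : Type*) [Field K] (e d : ℕ) : Matrix (VanCycle e d) (VanCycle e d) K :=
  1 - (intersectionMatrix e d).map (Int.cast : ℤ → K)

/-- The coordinate vector of a vanishing cycle in the basis of all vanishing cycles. -/
def cycleVec (K : Type*) [Field K] {e d : ℕ} (δ : VanCycle e d) : VanCycle e d → K :=
  Pi.single δ 1

/-- `Mon(δ)`: the subspace spanned by the orbit of `δ` under the monodromy, i.e. the Krylov space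
spanned by the vectors `M_e ^ l δ` for `0 ≤ l ≤ N - 1`, where `N = (e - 1) (d - 1)` is the number of
vanishing cycles. -/
def Mon (K : Type*) [Field K] {e d : ℕ} (δ : VanCycle e d) : Submodule K (VanCycle e d → K) :=
  Submodule.span K
    {v | ∃ l : ℕ, l < (e - 1) * (d - 1) ∧ v = (monodromyMatrix K e d ^ l).mulVec (cycleVec K δ)}

/-! Let `p`, `q` be the adjacency operators of the rows and columns and `s`, `t` the parity signs.
The index order depends only on parities, so `M_e = 1 + T` with `T = p s + q t - p q (s + t) / 2`
(`monodromyMatrix_eq`). Here `s` anticommutes with `p`, `t` with `q`, and all other pairs commute;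
hence `T` commutes with `p²` and `q²`, and a quartic identity (`gridVar_quartic`) relates `T²`, `p²`
and `q²`.

Upper bound on `Mon(δ)`: subspaces stable under `p`, `q`, `s`, `t` are stable under `M_e`.
Orthogonality to the odd `2r`-periodic functions of the column confines the columns to multiples of
`r`; for `e = 4` the symmetry of rows 1 and 3 confines the orbit of row 2.

Lower bound, over `ℂ`: `T` is skew-Hermitian. If each eigenvalue of `T` determines those of `p²` and
`q²`, every `T`-stable subspace is stable under both squares (`mem_of_joint_eigenvalues`). For `e =
3, 4` with `e ∤ d` this separation follows from Kronecker's theorem: a coincidence produces an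
algebraic integer with all conjugates inside the unit disc, hence `0`, and this forces `e ∣ d`. The
subspace then contains `p v` and `q v` for each of its vectors `v` of definite parities
(`IsGrid.adj_mem`); for `e = 2` this is immediate. A Chebyshev recurrence makes the set of positions
of its cycles closed under point reflections, so it contains all multiples of the gcd in each
direction (`AdjClosed.cycleVec_mem`). The generators are integral, so membership passes from `ℂ` to
`K` through `ℚ`.

If `e ∣ d`, the two paths share the eigenvalue `2 cos(π/e)`, which makes the kernel of `T` at least
two-dimensional. For `e = 2`, `T = q t`, whose spectrum comes from that of a path. -/

open scoped Kronecker ComplexOrder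

/-! ### Grid operators and their relations. -/

/-- The adjacency matrix of the path with vertices `1, …, n - 1`. -/
def pathAdj (K : Type*) [Field K] (n : ℕ) : Matrix (Finset.Ico 1 n) (Finset.Ico 1 n) K :=
  Matrix.of fun a b => if (a : ℕ) + 1 = b ∨ (b : ℕ) + 1 = a then 1 else 0

/-- The diagonal matrix of the bipartition of the path with vertices `1, …, n - 1`. -/
def pathSign (K : Type*) [Field K] (n : ℕ) : Matrix (Finset.Ico 1 n) (Finset.Ico 1 n) K :=
  Matrix.diagonal fun a => (-1) ^ (a : ℕ)

/-- Adjacency between the rows of the grid of vanishing cycles. -/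
def rowAdj (K : Type*) [Field K] (e d : ℕ) : Matrix (VanCycle e d) (VanCycle e d) K :=
  pathAdj K e ⊗ₖ 1

/-- Adjacency between the columns of the grid of vanishing cycles. -/
def colAdj (K : Type*) [Field K] (e d : ℕ) : Matrix (VanCycle e d) (VanCycle e d) K :=
  1 ⊗ₖ pathAdj K d

/-- The sign of the parity of the row. -/
def rowSign (K : Type*) [Field K] (e d : ℕ) : Matrix (VanCycle e d) (VanCycle e d) K :=
  pathSign K e ⊗ₖ 1

/-- The sign of the parity of the column. -/
def colSign (K : Type*) [Field K] (e d : ℕ) : Matrix (VanCycle e d) (VanCycle e d) K :=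
  1 ⊗ₖ pathSign K d

/-- The relations between the adjacency operators `p`, `q` and the parity signs `s`, `t` of a
grid. -/
structure IsGrid {B : Type*} [Ring B] (p q s t : B) : Prop where
  ss : s * s = 1
  tt : t * t = 1
  ts : t * s = s * t
  qp : q * p = p * q
  sp : s * p = -(p * s)
  sq : s * q = q * s
  tp : t * p = p * t
  tq : t * q = -(q * t)

lemma IsGrid.map {B C : Type*} [Ring B] [Ring C] {p q s t : B} (h : IsGrid p q s t)
    (f : B →+* C) : IsGrid (f p) (f q) (f s) (f t) := by
  constructor <;> simp only [← map_mul, ← map_neg, ← map_one f] <;> congr 1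
  exacts [h.ss, h.tt, h.ts, h.qp, h.sp, h.sq, h.tp, h.tq]

section
variable (K : Type*) [Field K]

lemma pathSign_mul_self (n : ℕ) : pathSign K n * pathSign K n = 1 := by
  rw [pathSign, Matrix.diagonal_mul_diagonal, ← Matrix.diagonal_one]
  congr 1; funext a
  simp [← mul_pow]

lemma pathSign_mul_pathAdj (n : ℕ) : pathSign K n * pathAdj K n = -(pathAdj K n * pathSign K n) := by
  ext a b
  simp only [pathSign, Matrix.diagonal_mul, Matrix.neg_apply, Matrix.mul_diagonal, pathAdj,
    Matrix.of_apply]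
  split_ifs with h
  · rcases h with h | h <;> rw [← h, pow_succ] <;> ring
  · simp

lemma isGrid_matrix (e d : ℕ) :
    IsGrid (rowAdj K e d) (colAdj K e d) (rowSign K e d) (colSign K e d) := by
  constructor <;> simp only [rowAdj, colAdj, rowSign, colSign, ← Matrix.mul_kronecker_mul, mul_one,
    one_mul, pathSign_mul_self, Matrix.one_kronecker_one, pathSign_mul_pathAdj]
  · ext; simp
  · ext; simp

lemma pathAdj_apply_comm (n : ℕ) (a b : Finset.Ico 1 n) : pathAdj K n a b = pathAdj K n b a := by
  simp only [pathAdj, Matrix.of_apply, or_comm]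

end

/-! ### Intersection numbers and the monodromy in terms of parities. -/

lemma enumIndex_inj {n a b : ℕ} (ha : a < n) (hb : b < n) :
    enumIndex n a = enumIndex n b ↔ a = b := by
  unfold enumIndex
  split_ifs with h1 h2 h2 <;> grind

lemma enumIndex_lt {n a b : ℕ} (ha : Even a) (ha' : a < n) (hb : ¬ Even b) :
    enumIndex n a < enumIndex n b := by
  unfold enumIndex
  rw [if_pos ha, if_neg hb]; grind

/-- Adjacency of positions with the sign attached to the order of their indices. -/
lemma sign_mul_zeroIntersection {n a b : ℕ} (ha : a < n) (hb : b < n) (hab : a ≠ b) :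
    ((enumIndex n b : ℤ) - enumIndex n a).sign * zeroIntersection a b =
      if a + 1 = b ∨ b + 1 = a then -(-1) ^ a else 0 := by
  unfold zeroIntersection
  rw [if_neg hab]
  split_ifs with h
  · rcases Nat.even_or_odd a with h' | h'
    · have := enumIndex_lt h' ha (b := b) (by grind)
      rw [Int.sign_eq_one_of_pos (by omega), h'.neg_one_pow]; rfl
    · have := enumIndex_lt (a := b) (b := a) (n := n) (by grind) hb (by grind)
      rw [Int.sign_eq_neg_one_of_neg (by omega), h'.neg_one_pow]; rfl
  · simp

/-- The enumeration lists even positions before odd ones, so between neighbours the sign of the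
index difference is a parity sign. A diagonal pair contributes only when row and column have equal
parity, that is, half the sum of the two signs; doubling keeps the formula integral. -/
lemma intersectionNumber_eq (e d : ℕ) (δ δ' : VanCycle e d) :
    2 * intersectionNumber e d δ δ' =
      (if δ.row = δ'.row then
        if δ.col + 1 = δ'.col ∨ δ'.col + 1 = δ.col then -2 * (-1) ^ δ.col else 0 else 0) +
      (if δ.col = δ'.col then
        if δ.row + 1 = δ'.row ∨ δ'.row + 1 = δ.row then -2 * (-1) ^ δ.row else 0 else 0) +
      (if (δ.row + 1 = δ'.row ∨ δ'.row + 1 = δ.row) ∧ (δ.col + 1 = δ'.col ∨ δ'.col + 1 = δ.col)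
        then ((-1) ^ δ.row + (-1) ^ δ.col) else 0) := by
  have h1 := (Finset.mem_Ico.1 δ.1.2).2
  have h2 := (Finset.mem_Ico.1 δ.2.2).2
  have h3 := (Finset.mem_Ico.1 δ'.1.2).2
  have h4 := (Finset.mem_Ico.1 δ'.2.2).2
  change δ.row < e at h1
  change δ.col < d at h2
  change δ'.row < e at h3
  change δ'.col < d at h4
  simp only [intersectionNumber, ne_eq, Nat.cast_inj, enumIndex_inj h1 h3, enumIndex_inj h2 h4]
  by_cases hr : δ.row = δ'.row
  · by_cases hc : δ.col = δ'.col
    · simp [hr, hc]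
    · rw [if_pos ⟨hr, hc⟩, sign_mul_zeroIntersection h2 h4 hc]
      simp only [hr, hc, if_true, if_false]
      split_ifs <;> omega
  · by_cases hc : δ.col = δ'.col
    · rw [if_neg (by tauto), if_pos ⟨hc, hr⟩, sign_mul_zeroIntersection h1 h3 hr]
      simp only [hr, hc, if_true, if_false]
      split_ifs <;> omega
    · rw [if_neg (by tauto), if_neg (by tauto)]
      simp only [hr, hc, if_false, zero_add]
      have k1 := sign_mul_zeroIntersection h1 h3 hr
      have k2 := sign_mul_zeroIntersection h2 h4 hc
      by_cases ar : δ.row + 1 = δ'.row ∨ δ'.row + 1 = δ.row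
      · by_cases ac : δ.col + 1 = δ'.col ∨ δ'.col + 1 = δ.col
        · have z1 : zeroIntersection δ.row δ'.row = -1 := by simp [zeroIntersection, hr, ar]
          have z2 : zeroIntersection δ.col δ'.col = -1 := by simp [zeroIntersection, hc, ac]
          rw [if_pos ar, z1] at k1
          rw [if_pos ac, z2] at k2
          rw [if_pos (show (_ ∨ _) ∧ (_ ∨ _) from ⟨ar, ac⟩)]
          simp only [z1, z2, ← Int.sign_eq_one_iff_pos, Int.sign_mul]
          have k1' : ((enumIndex e δ'.row : ℤ) - enumIndex e δ.row).sign = (-1) ^ δ.row := by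
            linarith
          have k2' : ((enumIndex d δ'.col : ℤ) - enumIndex d δ.col).sign = (-1) ^ δ.col := by
            linarith
          rw [k1', k2']
          rcases neg_one_pow_eq_or ℤ δ.row with u | u <;>
            rcases neg_one_pow_eq_or ℤ δ.col with w | w <;> rw [u, w] <;> norm_num
        · have z2 : zeroIntersection δ.col δ'.col = 0 := by simp [zeroIntersection, hc, ac]
          simp [z2, ac]
      · have z1 : zeroIntersection δ.row δ'.row = 0 := by simp [zeroIntersection, hr, ar]
        simp [z1, ar]

section
variable (K : Type*) [Field K] {e d : ℕ} (δ δ' : VanCycle e d)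

lemma rowAdj_apply : rowAdj K e d δ δ' =
    if δ.col = δ'.col then if δ.row + 1 = δ'.row ∨ δ'.row + 1 = δ.row then 1 else 0 else 0 := by
  change pathAdj K e δ.1 δ'.1 * (1 : Matrix _ _ K) δ.2 δ'.2 = _
  rw [Matrix.one_apply, mul_ite, mul_one, mul_zero]
  exact if_congr Subtype.ext_iff rfl rfl

lemma colAdj_apply : colAdj K e d δ δ' =
    if δ.row = δ'.row then if δ.col + 1 = δ'.col ∨ δ'.col + 1 = δ.col then 1 else 0 else 0 := by
  change (1 : Matrix _ _ K) δ.1 δ'.1 * pathAdj K d δ.2 δ'.2 = _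
  rw [Matrix.one_apply, ite_mul, one_mul, zero_mul]
  exact if_congr Subtype.ext_iff rfl rfl

lemma rowAdj_mul_colAdj_apply : (rowAdj K e d * colAdj K e d) δ δ' =
    if (δ.row + 1 = δ'.row ∨ δ'.row + 1 = δ.row) ∧ (δ.col + 1 = δ'.col ∨ δ'.col + 1 = δ.col)
    then 1 else 0 := by
  have e3 : rowAdj K e d * colAdj K e d = pathAdj K e ⊗ₖ pathAdj K d := by
    rw [rowAdj, colAdj, ← Matrix.mul_kronecker_mul, one_mul, mul_one]
  rw [e3]
  change pathAdj K e δ.1 δ'.1 * pathAdj K d δ.2 δ'.2 = _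
  simp only [pathAdj, Matrix.of_apply]
  rw [ite_zero_mul_ite_zero, mul_one]
  rfl

variable (e d)

lemma rowSign_eq : rowSign K e d = Matrix.diagonal fun δ => (-1) ^ δ.row := by
  ext a b
  change Matrix.diagonal _ a.1 b.1 * (1 : Matrix _ _ K) a.2 b.2 = _
  simp only [Matrix.diagonal_apply, Matrix.one_apply, Prod.ext_iff, VanCycle.row]
  split_ifs <;> simp_all

lemma colSign_eq : colSign K e d = Matrix.diagonal fun δ => (-1) ^ δ.col := by
  ext a b
  change (1 : Matrix _ _ K) a.1 b.1 * Matrix.diagonal _ a.2 b.2 = _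
  simp only [Matrix.diagonal_apply, Matrix.one_apply, Prod.ext_iff, VanCycle.col]
  split_ifs <;> simp_all

/-- The monodromy matrix in terms of adjacency and parity of rows and columns. -/
lemma monodromyMatrix_eq [CharZero K] :
    monodromyMatrix K e d = 1 + (rowAdj K e d * rowSign K e d + colAdj K e d * colSign K e d -
      (2⁻¹ : K) • (rowAdj K e d * colAdj K e d * (rowSign K e d + colSign K e d))) := by
  rw [monodromyMatrix, sub_eq_add_neg]
  congr 1
  ext δ δ'
  have h := congrArg (Int.cast : ℤ → K) (intersectionNumber_eq e d δ' δ)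
  have h2 : (2 : K) ≠ 0 := two_ne_zero
  rw [← mul_right_inj' h2]
  rw [rowSign_eq, colSign_eq, Matrix.diagonal_add]
  simp only [Matrix.neg_apply, Matrix.map_apply, intersectionMatrix, Matrix.of_apply,
    Matrix.sub_apply, Matrix.add_apply, Matrix.mul_diagonal, Matrix.smul_apply, smul_eq_mul,
    rowAdj_apply, colAdj_apply, rowAdj_mul_colAdj_apply]
  push_cast at h
  rw [mul_neg, h, mul_sub, mul_inv_cancel_left₀ h2]
  simp only [eq_comm (a := δ'.row) (b := δ.row), eq_comm (a := δ'.col) (b := δ.col),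
    or_comm (a := δ'.row + 1 = δ.row), or_comm (a := δ'.col + 1 = δ.col)]
  split_ifs <;> first | omega | ring_nf

end

/-! ### Algebra of the variation `T`. -/

/-- The variation `M - 1` of the monodromy in terms of the grid operators. -/
def gridVar (K : Type*) [Field K] {B : Type*} [Ring B] [Algebra K B] (p q s t : B) : B :=
  p * s + q * t - (2⁻¹ : K) • (p * q * (s + t))

namespace IsGrid
section
variable {K : Type*} [Field K] [CharZero K] {B : Type*} [Ring B] [Algebra K B] {p q s t : B}
  (h : IsGrid p q s t)
include h

lemma ts' (z : B) : t * (s * z) = s * (t * z) := by rw [← mul_assoc, h.ts, mul_assoc]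
lemma qp' (z : B) : q * (p * z) = p * (q * z) := by rw [← mul_assoc, h.qp, mul_assoc]
lemma sp' (z : B) : s * (p * z) = -(p * (s * z)) := by
  rw [← mul_assoc, h.sp, neg_mul, mul_assoc]
lemma sq' (z : B) : s * (q * z) = q * (s * z) := by rw [← mul_assoc, h.sq, mul_assoc]
lemma tp' (z : B) : t * (p * z) = p * (t * z) := by rw [← mul_assoc, h.tp, mul_assoc]
lemma tq' (z : B) : t * (q * z) = -(q * (t * z)) := by
  rw [← mul_assoc, h.tq, neg_mul, mul_assoc]

omit [CharZero K] in
lemma gridVar_commute_row : gridVar K p q s t * (p * p) = p * p * gridVar K p q s t := by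
  simp only [gridVar, mul_add, add_mul, sub_mul, mul_sub, smul_mul_assoc, mul_smul_comm, mul_assoc,
    h.sp, h.sp', h.tp, h.tp', h.qp', mul_neg, neg_neg]

omit [CharZero K] in
lemma gridVar_commute_col : gridVar K p q s t * (q * q) = q * q * gridVar K p q s t := by
  simp only [gridVar, mul_add, add_mul, sub_mul, mul_sub, smul_mul_assoc, mul_smul_comm, mul_assoc,
    h.sq, h.sq', h.tq, h.tq', h.qp', mul_neg, neg_neg]

lemma gridVar_sq : gridVar K p q s t * gridVar K p q s t =
    2 * (p * q * s * t) + p * p * q + q * q * p - p * p - q * q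
      - (2⁻¹ : K) • (p * p * q * q * (1 + s * t)) := by
  have h2 : (2 : K) ≠ 0 := two_ne_zero
  simp only [gridVar, mul_add, add_mul, sub_mul, mul_sub, smul_mul_assoc, mul_smul_comm, mul_assoc,
    h.sq', h.tq', h.sp', h.tp', h.qp, h.qp', h.ss, h.tt, h.ts,
    mul_neg, mul_one, two_mul, smul_neg, smul_add, smul_sub]
  match_scalars <;> field_simp <;> norm_num

/-- The bracket equals `2pqst + p²q + q²p - p²q²st/2`. In its square the terms odd in `st` cancel,
since `st` anticommutes with `p` and with `q`, and the two contributions to `p³q³` cancel as well;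
only `p²` and `q²` remain. -/
lemma gridVar_quartic :
    (gridVar K p q s t * gridVar K p q s t + p * p + q * q + (2⁻¹ : K) • (p * p * q * q)) *
      (gridVar K p q s t * gridVar K p q s t + p * p + q * q + (2⁻¹ : K) • (p * p * q * q)) =
    (4⁻¹ : K) • (p * p * q * q * (p * p + 4) * (q * q + 4)) := by
  have h2 : (2 : K) ≠ 0 := two_ne_zero
  have e : gridVar K p q s t * gridVar K p q s t + p * p + q * q + (2⁻¹ : K) • (p * p * q * q) =
      2 * (p * q * s * t) + p * p * q + q * q * p - (2⁻¹ : K) • (p * p * q * q * (s * t)) := by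
    rw [h.gridVar_sq, mul_add, mul_one, smul_add]; abel
  rw [e, show (4 : B) = 1 + 1 + 1 + 1 by norm_num]
  simp only [mul_add, add_mul, sub_mul, mul_sub, smul_mul_assoc, mul_smul_comm, mul_assoc,
    h.sq', h.tq, h.tq', h.sp', h.tp', h.qp, h.qp', h.ss, h.tt,
    h.ts', mul_neg, neg_neg, mul_one, two_mul, smul_neg, smul_add, smul_sub]
  match_scalars <;> field_simp <;> norm_num
end
end IsGrid
-- From stability under `T`, `p²`, `q²` to closure under neighbours.
namespace IsGrid
section
variable {K : Type*} [Field K] [CharZero K] {V : Type*} [AddCommGroup V] [Module K V]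
  {p q s t : Module.End K V} (h : IsGrid p q s t)
include h

omit [CharZero K] in
lemma apply_rules (z : V) : q (p z) = p (q z) ∧ s (p z) = -p (s z) ∧ s (q z) = q (s z) ∧
    t (p z) = p (t z) ∧ t (q z) = -q (t z) :=
  ⟨LinearMap.congr_fun h.qp z, LinearMap.congr_fun h.sp z, LinearMap.congr_fun h.sq z,
    LinearMap.congr_fun h.tp z, LinearMap.congr_fun h.tq z⟩

lemma eigenvalue_relation {v : V} (hv : v ≠ 0) {l x y : K} (hl : gridVar K p q s t v = l • v)
    (hx : p (p v) = x • v) (hy : q (q v) = y • v) :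
    (-l ^ 2) ^ 2 + x ^ 2 + y ^ 2 - 2 * x * y - 2 * x * (-l ^ 2) - 2 * y * (-l ^ 2)
      - x * y * (-l ^ 2) = 0 := by
  have e := LinearMap.congr_fun (h.gridVar_quartic (K := K)) v
  have h4 : (4 : Module.End K V) = (4 : K) • 1 := by
    rw [Algebra.smul_def, mul_one, map_ofNat]
  rw [h4] at e
  simp only [Module.End.mul_apply, LinearMap.add_apply, LinearMap.smul_apply, hl, hx, hy, map_smul,
    Module.End.one_apply, smul_smul, ← add_smul] at e
  have := smul_left_injective K hv e
  linear_combination this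

-- `hXY` and `hx₀` allow division by `p² + q² + 4` and by `q² - x₀` inside `S`, where `x₀` is the
-- nonzero eigenvalue of `p²` in the applications with `e = 3, 4`.
variable (S : Submodule K V) (hT : ∀ v ∈ S, gridVar K p q s t v ∈ S)
  (hX : ∀ v ∈ S, p (p v) ∈ S) (hY : ∀ v ∈ S, q (q v) ∈ S)
  (hXY : ∀ v, p (p v) + q (q v) + (4 : K) • v ∈ S → v ∈ S)
  {x₀ : K} (hp : ∀ v, p (p (p v)) = x₀ • p v) (hx₀ : ∀ v, q (q v) - x₀ • v ∈ S → v ∈ S)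

omit [CharZero K] h in
lemma gridVar_apply (v : V) : gridVar K p q s t v =
    p (s v) + q (t v) - (2⁻¹ : K) • (p (q (s v)) + p (q (t v))) := by
  simp [gridVar]

include hT hX hY hXY hp hx₀

/-- The case of vectors in rows and columns of the same parity. -/
lemma adj_mem_of_eq {v : V} (hv : v ∈ S) {c : K} (hc : c = 1 ∨ c = -1) (hs : s v = c • v)
    (ht : t v = c • v) : p v ∈ S ∧ q v ∈ S := by
  have r := h.apply_rules
  have cc : c * c = 1 := by rcases hc with rfl | rfl <;> norm_num
  have hTv : gridVar K p q s t v = c • (p v + q v - p (q v)) := by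
    rw [gridVar_apply, hs, ht]
    simp only [map_smul]
    module
  -- The added squares cancel the pure terms of `T² v`, so that only mixed terms in `p` and `q`
  -- survive.
  set D := gridVar K p q s t (gridVar K p q s t v) + p (p v) + q (q v) + p (p (q (q v))) with hD
  have hDm : D ∈ S := S.add_mem (S.add_mem (S.add_mem (hT _ (hT _ hv)) (hX _ hv)) (hY _ hv))
    (hX _ (hY _ hv))
  have hDe : D = p (q (q v)) + p (p (q v)) + (2 : K) • p (q v) := by
    rw [hD, hTv, gridVar_apply]
    simp only [map_smul, map_sub, map_add, map_neg, r, hs, ht]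
    rcases hc with rfl | rfl <;> module
  have hTD : c • gridVar K p q s t D = p (p (p (q v))) + p (q (q (q v)))
      - (2 : K) • (p (p (q v)) + p (q (q v))) := by
    rw [hDe, gridVar_apply]
    simp only [map_smul, map_add, map_neg, r, hs, ht]
    rcases hc with rfl | rfl <;> module
  -- `c T D + 2 D` is `(p² + q² + 4) p q v`, and the first factor can be divided out.
  have hcm : p (q v) ∈ S := by
    apply hXY
    have : p (p (p (q v))) + q (q (p (q v))) + (4 : K) • p (q v) =
        c • gridVar K p q s t D + (2 : K) • D := by
      rw [hTD, hDe]
      simp only [r]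
      module
    rw [this]
    exact S.add_mem (S.smul_mem _ (hT _ hDm)) (S.smul_mem _ hDm)
  have hab : p v + q v ∈ S := by
    have : p v + q v = c • gridVar K p q s t v + p (q v) := by
      rw [hTv, smul_smul, cc]; module
    rw [this]
    exact S.add_mem (S.smul_mem _ (hT _ hv)) hcm
  -- Removing `2 p q v` and `p² (p v + q v)` from `D` leaves `(q² - p²) p v`, which is `(q² - x₀) p
  -- v`.
  have ha : p v ∈ S := by
    apply hx₀
    have : q (q (p v)) - x₀ • p v = D - (2 : K) • p (q v) - p (p (p v + q v)) := by
      rw [hDe, ← hp]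
      simp only [map_add, r]
      module
    rw [this]
    exact S.sub_mem (S.sub_mem hDm (S.smul_mem _ hcm)) (hX _ hab)
  exact ⟨ha, (S.add_mem_iff_right ha).1 hab⟩

/-- The case of vectors in rows and columns of different parity. -/
lemma adj_mem_of_neg {v : V} (hv : v ∈ S) {c : K} (hc : c = 1 ∨ c = -1) (hs : s v = c • v)
    (ht : t v = (-c) • v) : p v ∈ S ∧ q v ∈ S := by
  have r := h.apply_rules
  have cc : c * c = 1 := by rcases hc with rfl | rfl <;> norm_num
  have hTv : gridVar K p q s t v = c • (p v - q v) := by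
    rw [gridVar_apply, hs, ht]
    simp only [map_smul]
    module
  have hE : p v - q v ∈ S := by
    have : p v - q v = c • gridVar K p q s t v := by rw [hTv, smul_smul, cc, one_smul]
    rw [this]
    exact S.smul_mem _ (hT _ hv)
  set D := gridVar K p q s t (gridVar K p q s t v) + p (p v) + q (q v) with hD
  have hDm : D ∈ S := S.add_mem (S.add_mem (hT _ (hT _ hv)) (hX _ hv)) (hY _ hv)
  have hDe : D = p (q (q v)) + p (p (q v)) - (2 : K) • p (q v) := by
    rw [hD, hTv, gridVar_apply]
    simp only [map_smul, map_sub, map_neg, r, hs, ht]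
    rcases hc with rfl | rfl <;> module
  have hTD : c • gridVar K p q s t D = p (p (p (q v))) - p (q (q (q v)))
      - p (p (q (q (p v - q v)))) + (2 : K) • (p (p (q v)) - p (q (q v))) := by
    rw [hDe, gridVar_apply]
    simp only [map_smul, map_sub, map_add, map_neg, r, hs, ht]
    rcases hc with rfl | rfl <;> module
  -- Opposite parities reverse the order: `q² - x₀` is divided out first, giving this combination,
  -- and then `p² + q² + 4` isolates `p v`.
  have hca : p (q v) + (2 : K) • p v ∈ S := by
    apply hx₀
    have : q (q (p (q v) + (2 : K) • p v)) - x₀ • (p (q v) + (2 : K) • p v) =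
        -(c • gridVar K p q s t D + p (p (q (q (p v - q v)))) + (2 : K) • p (p (p v - q v))) := by
      rw [hTD, smul_add, smul_comm x₀ (2 : K) (p v), ← hp, ← hp]
      simp only [map_add, map_sub, map_smul, r]
      module
    rw [this]
    exact S.neg_mem (S.add_mem (S.add_mem (S.smul_mem _ (hT _ hDm)) (hX _ (hY _ hE)))
      (S.smul_mem _ (hX _ hE)))
  have ha : p v ∈ S := by
    apply hXY
    have : p (p (p v)) + q (q (p v)) + (4 : K) • p v =
        D + p (p (p v - q v)) + (2 : K) • (p (q v) + (2 : K) • p v) := by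
      rw [hDe]
      simp only [map_sub, r]
      module
    rw [this]
    exact S.add_mem (S.add_mem hDm (hX _ hE)) (S.smul_mem _ hca)
  exact ⟨ha, (S.sub_mem_iff_right ha).1 hE⟩

/-- A subspace stable under the monodromy and under the squares of the adjacency operators contains
the neighbours of its homogeneous vectors. -/
theorem adj_mem {v : V} (hv : v ∈ S) {c c' : K} (hc : c = 1 ∨ c = -1) (hc' : c' = 1 ∨ c' = -1)
    (hs : s v = c • v) (ht : t v = c' • v) : p v ∈ S ∧ q v ∈ S := by
  by_cases e : c' = c
  · exact h.adj_mem_of_eq S hT hX hY hXY hp hx₀ hv hc hs (e ▸ ht)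
  · have : c' = -c := by
      rcases hc with rfl | rfl <;> rcases hc' with rfl | rfl <;> simp_all
    exact h.adj_mem_of_neg S hT hX hY hXY hp hx₀ hv hc hs (this ▸ ht)

end
end IsGrid

/-! ### Arithmetic separation of eigenvalues. -/

/-- An algebraic integer all of whose conjugates have absolute value less than `1` vanishes. -/
lemma eq_zero_of_forall_norm_lt_one {L : Type*} [Field L] [NumberField L] {x : L}
    (hx : IsIntegral ℤ x) (h : ∀ φ : L →+* ℂ, ‖φ x‖ < 1) : x = 0 := by
  by_contra h0
  obtain ⟨n, hn, e⟩ := NumberField.Embeddings.pow_eq_one_of_norm_le_one L ℂ h0 hx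
    fun φ => (h φ).le
  obtain ⟨φ⟩ : Nonempty (L →+* ℂ) := inferInstance
  have h1 : ‖φ x‖ ^ n = 1 := by rw [← norm_pow, ← map_pow, e, map_one, norm_one]
  exact (pow_lt_one₀ (norm_nonneg _) (h φ) hn.ne').ne h1

/-- The numbers `4 cos² (k π / d)`. -/
def IsCosSq (d : ℕ) (y : ℂ) : Prop := ∃ η : ℂ, η ^ d = 1 ∧ y = 2 + η + η⁻¹

lemma IsCosSq.conj_mem {L : Type*} [Field L] {d : ℕ} (hd : d ≠ 0) {η : L} (h : η ^ d = 1)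
    (φ : L →+* ℂ) : ∃ r : ℝ, 0 ≤ r ∧ r ≤ 4 ∧ φ (2 + η + η⁻¹) = r := by
  have h1 : ‖φ η‖ = 1 := Complex.norm_eq_one_of_pow_eq_one (by rw [← map_pow, h, map_one]) hd
  have h2 : (φ η)⁻¹ = (starRingEnd ℂ) (φ η) := Complex.inv_eq_conj h1
  have h3 := Complex.abs_re_le_norm (φ η)
  rw [h1, abs_le] at h3
  refine ⟨2 + 2 * (φ η).re, by linarith, by linarith, ?_⟩
  rw [map_add, map_add, map_inv₀, h2, map_ofNat, add_assoc, Complex.add_conj]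
  push_cast; rfl

/-- Both numbers lie in one cyclotomic field, where every embedding sends them into `[0, 4]`; the
bounds for Kronecker's theorem can thus be checked for all conjugates at once. -/
lemma IsCosSq.exists_numberField {d : ℕ} (hd : d ≠ 0) {y y' : ℂ} (hy : IsCosSq d y)
    (hy' : IsCosSq d y') : ∃ (L : Type) (_ : Field L) (_ : NumberField L) (ι : L →+* ℂ) (a a' : L),
      ι a = y ∧ ι a' = y' ∧ IsIntegral ℤ a ∧ IsIntegral ℤ a' ∧
      ∀ φ : L →+* ℂ, (∃ r : ℝ, 0 ≤ r ∧ r ≤ 4 ∧ φ a = r) ∧ (∃ r : ℝ, 0 ≤ r ∧ r ≤ 4 ∧ φ a' = r) := by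
  obtain ⟨η, h, rfl⟩ := hy
  obtain ⟨η', h', rfl⟩ := hy'
  have : NeZero d := ⟨hd⟩
  have : NeZero (d : ℚ) := ⟨Nat.cast_ne_zero.2 hd⟩
  obtain ⟨ι⟩ : Nonempty (CyclotomicField d ℚ →+* ℂ) := inferInstance
  obtain ⟨z, hz⟩ := (CyclotomicField.isCyclotomicExtension d ℚ).exists_isPrimitiveRoot
    (Set.mem_singleton d) hd
  have key : ∀ η : ℂ, η ^ d = 1 → ∃ ξ : CyclotomicField d ℚ, ξ ^ d = 1 ∧ ι ξ = η := by
    intro η h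
    obtain ⟨i, -, hi⟩ := (hz.map_of_injective ι.injective).eq_pow_of_pow_eq_one h
    exact ⟨_ ^ i, by rw [← pow_mul, mul_comm, pow_mul, hz.pow_eq_one, one_pow],
      by rw [map_pow]; exact hi⟩
  obtain ⟨ξ, hξ, rfl⟩ := key η h
  obtain ⟨ξ', hξ', rfl⟩ := key η' h'
  have hint : ∀ ξ : CyclotomicField d ℚ, ξ ^ d = 1 → IsIntegral ℤ (2 + ξ + ξ⁻¹) := by
    intro ξ h
    have i1 : ∀ ξ : CyclotomicField d ℚ, ξ ^ d = 1 → IsIntegral ℤ ξ := fun ξ h =>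
      IsIntegral.of_pow (Nat.pos_of_ne_zero hd) (h ▸ isIntegral_one)
    exact ((isIntegral_algebraMap (R := ℤ) (x := 2)).add (i1 ξ h)).add
      (i1 _ (by rw [inv_pow, h, inv_one]))
  exact ⟨_, _, inferInstance, ι, 2 + ξ + ξ⁻¹, 2 + ξ' + ξ'⁻¹,
    by simp only [map_add, map_ofNat, map_inv₀], by simp only [map_add, map_ofNat, map_inv₀],
     hint ξ hξ, hint ξ' hξ',
    fun φ => ⟨IsCosSq.conj_mem hd hξ φ, IsCosSq.conj_mem hd hξ' φ⟩⟩

/-- The value `1` makes `η` a primitive cube root of unity. -/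
lemma IsCosSq.ne_one {d : ℕ} (h3 : ¬ 3 ∣ d) : ¬ IsCosSq d 1 := by
  rintro ⟨η, h, e⟩
  have h0 : η ≠ 0 := by
    rintro rfl
    norm_num at e
  have e2 : η ^ 2 + η + 1 = 0 := by
    field_simp at e
    linear_combination -e
  have e3 : η ^ 3 = 1 := by linear_combination (η - 1) * e2
  have ne : η ≠ 1 := by rintro rfl; norm_num at e2
  exact h3 (orderOf_eq_prime (p := 3) e3 ne ▸ orderOf_dvd_of_pow_eq_one h)

/-- The value `2` makes `η` a primitive fourth root of unity. -/
lemma IsCosSq.ne_two {d : ℕ} (h4 : ¬ 4 ∣ d) : ¬ IsCosSq d 2 := by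
  rintro ⟨η, h, e⟩
  have h0 : η ≠ 0 := by
    rintro rfl
    have : (0 : ℂ) ^ d = 1 := h
    rcases Nat.eq_zero_or_pos d with rfl | hd
    · exact h4 (dvd_zero 4)
    · rw [zero_pow hd.ne'] at this
      exact zero_ne_one this
  have e2 : η ^ 2 = -1 := by
    field_simp at e
    linear_combination -e
  have e4 : η ^ (2 ^ (1 + 1)) = 1 := by
    norm_num
    linear_combination (η ^ 2 - 1) * e2
  have ne : ¬ η ^ (2 ^ 1) = 1 := by
    norm_num [e2]
  have ho : orderOf η = 4 := orderOf_eq_prime_pow ne e4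
  exact h4 (ho ▸ orderOf_dvd_of_pow_eq_one h)

/-- Separation of eigenvalues for three roots. -/
lemma IsCosSq.eq_of_relation_one {d : ℕ} (h3 : ¬ 3 ∣ d) {y y' l : ℂ} (hy : IsCosSq d y)
    (hy' : IsCosSq d y') (h : l ^ 2 + 1 + y ^ 2 - 2 * y - 2 * l - 2 * y * l - y * l = 0)
    (h' : l ^ 2 + 1 + y' ^ 2 - 2 * y' - 2 * l - 2 * y' * l - y' * l = 0) : y = y' := by
  have hd : d ≠ 0 := by rintro rfl; exact h3 (dvd_zero 3)
  by_contra hne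
  -- Distinct `y`, `y'` are the two roots of one quadratic, so its coefficients give their sum and
  -- product.
  have e1 : y + y' = 3 * l + 2 := by
    apply mul_left_cancel₀ (sub_ne_zero.2 hne)
    linear_combination h - h'
  have e2 : y * y' = (l - 1) ^ 2 := by
    linear_combination y * e1 - h
  obtain ⟨L, _, _, ι, a, a', rfl, rfl, ia, ia', hφ⟩ := hy.exists_numberField hd hy'
  obtain ⟨c, rfl⟩ : ∃ c : L, l = ι c := by
    refine ⟨(a + a' - 2) / 3, ?_⟩
    simp only [map_div₀, map_sub, map_add, map_ofNat]
    linear_combination -e1 / 3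
  have f1 : a + a' = 3 * c + 2 := ι.injective (by
    simp only [map_add, map_mul, map_ofNat]; exact e1)
  have f2 : a * a' = (c - 1) ^ 2 := ι.injective (by
    simp only [map_mul, map_sub, map_pow, map_one]; exact e2)
  have ic : IsIntegral ℤ c := by
    have : IsIntegral ℤ (c - 1) := IsIntegral.of_pow two_pos (f2 ▸ ia.mul ia')
    simpa using this.add isIntegral_one
  have c0 : c = 0 := by
    refine eq_zero_of_forall_norm_lt_one ic fun φ => ?_
    obtain ⟨⟨r, r0, r4, hr⟩, r', r0', r4', hr'⟩ := hφ φ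
    have g1 := congrArg φ f1
    have g2 := congrArg φ f2
    simp only [map_add, map_mul, map_sub, map_pow, map_ofNat, map_one, hr, hr'] at g1 g2
    have hc : φ c = ((r + r' - 2) / 3 : ℝ) := by
      push_cast
      linear_combination -g1 / 3
    rw [hc] at g2 ⊢
    norm_cast at g2
    rw [Complex.norm_real, Real.norm_eq_abs, abs_lt]
    -- In terms of `c = φ c`, `q1` reads `c² - 14c + 9 ≥ 0` and `q2` reads `5c(c + 4) ≥ 0`; with `0
    -- ≤ r + r' ≤ 8` they give `0 ≤ c < 1`.
    have q1 : 0 ≤ (4 - r) * (4 - r') := mul_nonneg (by linarith) (by linarith)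
    have q2 : 0 ≤ (r - r') ^ 2 := sq_nonneg _
    constructor
    · nlinarith
    · nlinarith
  rw [c0, map_zero] at h h'
  have : ι a = 1 := by
    have : (ι a - 1) ^ 2 = 0 := by linear_combination h
    exact sub_eq_zero.1 (pow_eq_zero_iff two_ne_zero |>.1 this)
  exact IsCosSq.ne_one h3 (this ▸ hy)

/-- Separation of eigenvalues for four roots. -/
lemma IsCosSq.eq_of_relation_two {d : ℕ} (h4 : ¬ 4 ∣ d) {y y' l : ℂ} (hy : IsCosSq d y)
    (hy' : IsCosSq d y') (h : l ^ 2 + 2 ^ 2 + y ^ 2 - 2 * 2 * y - 2 * 2 * l - 2 * y * l - 2 * y * l = 0)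
    (h' : l ^ 2 + 2 ^ 2 + y' ^ 2 - 2 * 2 * y' - 2 * 2 * l - 2 * y' * l - 2 * y' * l = 0) :
    y = y' := by
  have hd : d ≠ 0 := by rintro rfl; exact h4 (dvd_zero 4)
  by_contra hne
  have e1 : y + y' = 4 * l + 4 := by
    apply mul_left_cancel₀ (sub_ne_zero.2 hne)
    linear_combination h - h'
  have e2 : y * y' = (l - 2) ^ 2 := by
    linear_combination y * e1 - h
  obtain ⟨L, _, _, ι, a, a', rfl, rfl, ia, ia', hφ⟩ := hy.exists_numberField hd hy'
  obtain ⟨c, rfl⟩ : ∃ c : L, l = ι c := by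
    refine ⟨(a + a' - 4) / 4, ?_⟩
    simp only [map_div₀, map_sub, map_add, map_ofNat]
    linear_combination -e1 / 4
  have f1 : a + a' = 4 * c + 4 := ι.injective (by
    simp only [map_add, map_mul, map_ofNat]; exact e1)
  have f2 : a * a' = (c - 2) ^ 2 := ι.injective (by
    simp only [map_mul, map_sub, map_pow, map_ofNat]; exact e2)
  have ic : IsIntegral ℤ c := by
    have : IsIntegral ℤ (c - 2) := IsIntegral.of_pow two_pos (f2 ▸ ia.mul ia')
    simpa using this.add (isIntegral_algebraMap (R := ℤ) (x := 2))
  have c0 : c = 0 := by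
    refine eq_zero_of_forall_norm_lt_one ic fun φ => ?_
    obtain ⟨⟨r, r0, r4, hr⟩, r', r0', r4', hr'⟩ := hφ φ
    have g1 := congrArg φ f1
    have g2 := congrArg φ f2
    simp only [map_add, map_mul, map_sub, map_pow, map_ofNat, hr, hr'] at g1 g2
    have hc : φ c = ((r + r' - 4) / 4 : ℝ) := by
      push_cast
      linear_combination -g1 / 4
    rw [hc] at g2 ⊢
    norm_cast at g2
    rw [Complex.norm_real, Real.norm_eq_abs, abs_lt]
    -- Here `q1` reads `c² - 20c + 4 ≥ 0` and `q2` reads `12c(c + 4) ≥ 0`, again giving `0 ≤ c < 1`.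
    have q1 : 0 ≤ (4 - r) * (4 - r') := mul_nonneg (by linarith) (by linarith)
    have q2 : 0 ≤ (r - r') ^ 2 := sq_nonneg _
    constructor
    · nlinarith
    · nlinarith
  rw [c0, map_zero] at h h'
  have : ι a = 2 := by
    have : (ι a - 2) ^ 2 = 0 := by linear_combination h
    exact sub_eq_zero.1 (pow_eq_zero_iff two_ne_zero |>.1 this)
  exact IsCosSq.ne_two h4 (this ▸ hy)

/-- For `x = 0` the eigenvalue relation forces `l = y'`; substituted into the relation for `x = 2`
it gives `(y + y' - 2)² = 6yy'`. Then all conjugates of `yy'` are below `1`, so `yy' = 0` and one of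
the two numbers is `2`. -/
lemma IsCosSq.relation_zero_two {d : ℕ} (h4 : ¬ 4 ∣ d) {y y' : ℂ} (hy : IsCosSq d y)
    (hy' : IsCosSq d y') :
    y' ^ 2 + 2 ^ 2 + y ^ 2 - 2 * 2 * y - 2 * 2 * y' - 2 * y * y' - 2 * y * y' ≠ 0 := by
  intro h
  have hd : d ≠ 0 := by rintro rfl; exact h4 (dvd_zero 4)
  have e : (y + y' - 2) ^ 2 = 6 * (y * y') := by linear_combination h
  have h0 : y * y' = 0 := by
    obtain ⟨L, _, _, ι, a, a', rfl, rfl, ia, ia', hφ⟩ := hy.exists_numberField hd hy'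
    have f : (a + a' - 2) ^ 2 = 6 * (a * a') := ι.injective (by
    simp only [map_add, map_mul, map_sub, map_pow, map_ofNat]; exact e)
    rw [← map_mul, eq_zero_of_forall_norm_lt_one (ia.mul ia') fun φ => ?_, map_zero]
    obtain ⟨⟨r, r0, r4, hr⟩, r', r0', r4', hr'⟩ := hφ φ
    have g := congrArg φ f
    simp only [map_add, map_mul, map_sub, map_pow, map_ofNat, hr, hr'] at g ⊢
    norm_cast at g ⊢
    rw [Real.norm_eq_abs, abs_lt]
    have q1 : 0 ≤ (4 - r) * (4 - r') := mul_nonneg (by linarith) (by linarith)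
    have q2 : 0 ≤ r * r' := mul_nonneg r0 r0'
    refine ⟨by linarith, ?_⟩
    have hs : r + r' ≤ 17 / 4 := by nlinarith
    nlinarith
  have e' : (y + y' - 2) ^ 2 = 0 := by rw [e, h0, mul_zero]
  have e'' : y + y' = 2 := sub_eq_zero.1 (pow_eq_zero_iff two_ne_zero |>.1 e')
  rcases mul_eq_zero.1 h0 with rfl | rfl
  · rw [zero_add] at e''
    exact IsCosSq.ne_two h4 (e'' ▸ hy')
  · rw [add_zero] at e''
    exact IsCosSq.ne_two h4 (e'' ▸ hy)

/-! ### Diagonalization and joint eigenvalues. -/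

/-- Hermitian matrices are diagonalizable. -/
lemma Matrix.IsHermitian.iSup_eigenspace_eq_top {n : Type*} [Fintype n] [DecidableEq n]
    {A : Matrix n n ℂ} (hA : A.IsHermitian) :
    ⨆ μ, Module.End.eigenspace (Matrix.toLin' A) μ = ⊤ := by
  rw [eq_top_iff]
  intro v _
  have hv := hA.eigenvectorBasis.sum_repr (WithLp.toLp 2 v)
  have hv' : v = ∑ i, hA.eigenvectorBasis.repr (WithLp.toLp 2 v) i •
      WithLp.ofLp (hA.eigenvectorBasis i) := by
    conv_lhs => rw [← WithLp.ofLp_toLp 2 v, ← hv]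
    simp
  rw [hv']
  refine Submodule.sum_mem _ fun i _ => Submodule.smul_mem _ _ ?_
  refine Submodule.mem_iSup_of_mem ((hA.eigenvalues i : ℝ) : ℂ) ?_
  rw [Module.End.mem_eigenspace_iff, Matrix.toLin'_apply, hA.mulVec_eigenvectorBasis]
  rfl

section
variable {K V : Type*} [Field K] [AddCommGroup V] [Module K V] [FiniteDimensional K V]

lemma Submodule.eq_iSup_inf_eigenspace {f : Module.End K V}
    (hf : ⨆ μ, f.eigenspace μ = ⊤) {S : Submodule K V} (hS : ∀ v ∈ S, f v ∈ S) :
    S = ⨆ μ, S ⊓ f.eigenspace μ := by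
  have := Submodule.inf_iSup_genEigenspace hS 1
  rw [← this]
  change S = S ⊓ ⨆ μ, f.eigenspace μ
  rw [hf, inf_top_eq]

/-- Operators commuting with `T` whose joint eigenvalues are determined by those of `T` preserve the
`T`-stable subspaces. -/
lemma mem_of_joint_eigenvalues {T X Y : Module.End K V} (hT : ⨆ μ, T.eigenspace μ = ⊤)
    (hX : ⨆ μ, X.eigenspace μ = ⊤) (hY : ⨆ μ, Y.eigenspace μ = ⊤)
    (hTX : T * X = X * T) (hTY : T * Y = Y * T) (hXY : X * Y = Y * X)
    (hu : ∀ l x y x' y' : K, ∀ v v' : V, v ≠ 0 → v' ≠ 0 → T v = l • v → X v = x • v → Y v = y • v →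
      T v' = l • v' → X v' = x' • v' → Y v' = y' • v' → x = x' ∧ y = y')
    {S : Submodule K V} (hS : ∀ v ∈ S, T v ∈ S) : ∀ v ∈ S, X v ∈ S ∧ Y v ∈ S := by
  -- Each `T`-eigenspace splits into joint eigenspaces of `X` and `Y`, and by `hu` at most one of
  -- them is nonzero. So `X` and `Y` act on it as scalars.
  have key : ∀ l, ∃ x y, T.eigenspace l ≤ X.eigenspace x ⊓ Y.eigenspace y := by
    intro l
    have h1 : ∀ v ∈ T.eigenspace l, X v ∈ T.eigenspace l := by
      intro v hv
      rw [Module.End.mem_eigenspace_iff] at hv ⊢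
      rw [← Module.End.mul_apply, hTX, Module.End.mul_apply, hv, map_smul]
    have h2 : ∀ x, ∀ v ∈ T.eigenspace l ⊓ X.eigenspace x, Y v ∈ T.eigenspace l ⊓ X.eigenspace x := by
      intro x v hv
      rw [Submodule.mem_inf, Module.End.mem_eigenspace_iff, Module.End.mem_eigenspace_iff] at hv ⊢
      constructor
      · rw [← Module.End.mul_apply, hTY, Module.End.mul_apply, hv.1, map_smul]
      · rw [← Module.End.mul_apply, hXY, Module.End.mul_apply, hv.2, map_smul]
    have e : T.eigenspace l =
        ⨆ x, ⨆ y, (T.eigenspace l ⊓ X.eigenspace x) ⊓ Y.eigenspace y := by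
      conv_lhs => rw [Submodule.eq_iSup_inf_eigenspace hX h1]
      exact iSup_congr fun x => Submodule.eq_iSup_inf_eigenspace hY (h2 x)
    by_cases hne : ∃ x y, ∃ v ∈ (T.eigenspace l ⊓ X.eigenspace x) ⊓ Y.eigenspace y, v ≠ 0
    · obtain ⟨x, y, v, hv, h0⟩ := hne
      refine ⟨x, y, ?_⟩
      rw [e]
      refine iSup_le fun x' => iSup_le fun y' => ?_
      intro w hw
      by_cases hw0 : w = 0
      · rw [hw0]; exact Submodule.zero_mem _
      · simp only [Submodule.mem_inf, Module.End.mem_eigenspace_iff] at hv hw ⊢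
        obtain ⟨rfl, rfl⟩ := hu l x y x' y' v w h0 hw0 hv.1.1 hv.1.2 hv.2 hw.1.1 hw.1.2 hw.2
        exact ⟨hw.1.2, hw.2⟩
    · push Not at hne
      refine ⟨0, 0, ?_⟩
      rw [e]
      refine iSup_le fun x' => iSup_le fun y' => ?_
      intro w hw
      rw [hne x' y' w hw]
      exact Submodule.zero_mem _
  suffices h : S ≤ S.comap X ⊓ S.comap Y from fun v hv => h hv
  conv_lhs => rw [Submodule.eq_iSup_inf_eigenspace hT hS]
  refine iSup_le fun l => ?_
  intro v hv
  obtain ⟨x, y, hxy⟩ := key l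
  have hv' := hxy hv.2
  simp only [Submodule.mem_inf, Module.End.mem_eigenspace_iff, Submodule.mem_comap] at hv' ⊢
  rw [hv'.1, hv'.2]
  exact ⟨S.smul_mem _ hv.1, S.smul_mem _ hv.1⟩

end

/-! ### Odd periodic functions on paths and tensor products on the grid. -/

section
variable {K : Type*} [Field K]

lemma pathAdj_mulVec {n : ℕ} {g : ℕ → K} (h0 : g 0 = 0) (hn : g n = 0) (k : Finset.Ico 1 n) :
    (pathAdj K n).mulVec (fun a => g a) k = g (k - 1) + g (k + 1) := by
  have hk := Finset.mem_Ico.1 k.2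
  have e1 : (pathAdj K n).mulVec (fun a => g a) k =
      ∑ a ∈ Finset.range (n + 1), if (k : ℕ) + 1 = a ∨ a + 1 = k then g a else 0 := by
    rw [Matrix.mulVec, dotProduct]
    simp only [pathAdj, Matrix.of_apply, ite_mul, one_mul, zero_mul]
    rw [Finset.sum_coe_sort (Finset.Ico 1 n) (fun a => if (k : ℕ) + 1 = a ∨ a + 1 = k then g a else 0)]
    refine Finset.sum_subset (fun a ha => ?_) fun a ha ha' => ?_
    · rw [Finset.mem_Ico] at ha
      rw [Finset.mem_range]; omega
    · rw [Finset.mem_range] at ha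
      rw [Finset.mem_Ico] at ha'
      have : a = 0 ∨ a = n := by omega
      rcases this with rfl | rfl <;> simp [h0, hn]
  have e2 : ∀ a, (if (k : ℕ) + 1 = a ∨ a + 1 = k then g a else 0) =
      (if (k : ℕ) - 1 = a then g a else 0) + (if (k : ℕ) + 1 = a then g a else 0) := by
    intro a
    split_ifs <;> first | omega | simp
  rw [e1, Finset.sum_congr rfl fun a _ => e2 a, Finset.sum_add_distrib, Finset.sum_ite_eq,
    Finset.sum_ite_eq, if_pos (by rw [Finset.mem_range]; omega),
    if_pos (by rw [Finset.mem_range]; omega)]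

variable (K) in
/-- The odd `2 r`-periodic function supported on the classes of `m` and `-m`. -/
def foldVec (n r : ℕ) (m : ℤ) : Finset.Ico 1 n → K := fun k =>
  (if (2 * r : ℤ) ∣ (k : ℕ) - m then 1 else 0) - (if (2 * r : ℤ) ∣ (k : ℕ) + m then 1 else 0)

/-- As an odd `2r`-periodic function on `ℤ` the vector vanishes at `0` and, because `r ∣ n`, at `n`;
the ends of the path therefore need no correction. -/
lemma pathAdj_mulVec_foldVec {n r : ℕ} (hr : r ∣ n) (m : ℤ) :
    (pathAdj K n).mulVec (foldVec K n r m) = foldVec K n r (m - 1) + foldVec K n r (m + 1) := by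
  ext k
  have hk := Finset.mem_Ico.1 k.2
  have h := pathAdj_mulVec (n := n) (g := fun k : ℕ =>
    (if (2 * r : ℤ) ∣ k - m then (1 : K) else 0) - (if (2 * r : ℤ) ∣ k + m then 1 else 0))
    (by
      have : (2 * r : ℤ) ∣ (0 : ℕ) - m ↔ (2 * r : ℤ) ∣ (0 : ℕ) + m := by
        rw [← dvd_neg]; simp
      simp only [this, sub_self])
    (by
      have : (2 * r : ℤ) ∣ (n : ℤ) - m ↔ (2 * r : ℤ) ∣ n + m := by
        have h2 : (2 * r : ℤ) ∣ (n + m) + (n - m) := by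
          rw [show ((n : ℤ) + m) + (n - m) = 2 * n by ring]
          exact mul_dvd_mul_left 2 (Int.natCast_dvd_natCast.2 hr)
        exact ⟨fun h => (dvd_add_left h).1 h2, fun h => (dvd_add_right h).1 h2⟩
      simp only [this, sub_self]) k
  change (pathAdj K n).mulVec (foldVec K n r m) k = _ at h
  rw [h]
  simp only [foldVec, Pi.add_apply]
  rw [Nat.cast_sub hk.1]
  push_cast
  rw [show (k : ℤ) - 1 - m = k - (m + 1) by ring, show (k : ℤ) - 1 + m = k + (m - 1) by ring,
    show (k : ℤ) + 1 - m = k - (m - 1) by ring, show (k : ℤ) + 1 + m = k + (m + 1) by ring]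
  ring

lemma foldVec_self {n : ℕ} (m : Finset.Ico 1 n) : foldVec K n n (m : ℕ) = Pi.single m 1 := by
  ext k
  have hk := Finset.mem_Ico.1 k.2
  have hm := Finset.mem_Ico.1 m.2
  simp only [foldVec, Pi.single_apply]
  have h2 : ¬ (2 * n : ℤ) ∣ (k : ℕ) + (m : ℕ) := by
    intro h
    have := Int.le_of_dvd (by omega) h
    omega
  have h1 : (2 * n : ℤ) ∣ (k : ℕ) - (m : ℕ) ↔ k = m := by
    rw [Subtype.ext_iff]
    constructor
    · intro h
      have := Int.eq_zero_of_abs_lt_dvd h (by rw [abs_lt]; omega)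
      omega
    · intro h
      rw [h, sub_self]
      exact dvd_zero _
  simp [h1, h2]

lemma foldVec_zero (n r : ℕ) : foldVec K n r 0 = 0 := by
  ext k
  simp [foldVec]

lemma foldVec_r (n r : ℕ) : foldVec K n r r = 0 := by
  ext k
  have : (2 * r : ℤ) ∣ (k : ℕ) - r ↔ (2 * r : ℤ) ∣ (k : ℕ) + r := by
    rw [show ((k : ℕ) : ℤ) + r = (k : ℕ) - r + 2 * r by ring, dvd_add_self_right]
  simp only [foldVec, this, sub_self, Pi.zero_apply]

variable {e d : ℕ}

lemma rowAdj_mulVec (v : VanCycle e d → K) (δ : VanCycle e d) :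
    (rowAdj K e d).mulVec v δ = (pathAdj K e).mulVec (fun a => v (a, δ.2)) δ.1 := by
  rw [Matrix.mulVec, dotProduct, Fintype.sum_prod_type]
  refine Finset.sum_congr rfl fun a _ => ?_
  rw [Finset.sum_eq_single δ.2]
  · change pathAdj K e δ.1 a * (1 : Matrix _ _ K) δ.2 δ.2 * _ = _
    rw [Matrix.one_apply_eq, mul_one]
  · intro b _ hb
    change pathAdj K e δ.1 a * (1 : Matrix _ _ K) δ.2 b * _ = _
    rw [Matrix.one_apply_ne hb.symm, mul_zero, zero_mul]
  · simp

lemma colAdj_mulVec (v : VanCycle e d → K) (δ : VanCycle e d) :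
    (colAdj K e d).mulVec v δ = (pathAdj K d).mulVec (fun b => v (δ.1, b)) δ.2 := by
  rw [Matrix.mulVec, dotProduct, Fintype.sum_prod_type, Finset.sum_comm]
  refine Finset.sum_congr rfl fun a _ => ?_
  rw [Finset.sum_eq_single δ.1]
  · change (1 : Matrix _ _ K) δ.1 δ.1 * pathAdj K d δ.2 a * _ = _
    rw [Matrix.one_apply_eq, one_mul]
  · intro b _ hb
    change (1 : Matrix _ _ K) δ.1 b * pathAdj K d δ.2 a * _ = _
    rw [Matrix.one_apply_ne hb.symm, zero_mul, zero_mul]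
  · simp

lemma rowSign_mulVec (v : VanCycle e d → K) (δ : VanCycle e d) :
    (rowSign K e d).mulVec v δ = (-1) ^ δ.row * v δ := by
  rw [rowSign_eq, Matrix.mulVec_diagonal]

lemma colSign_mulVec (v : VanCycle e d → K) (δ : VanCycle e d) :
    (colSign K e d).mulVec v δ = (-1) ^ δ.col * v δ := by
  rw [colSign_eq, Matrix.mulVec_diagonal]

/-- The pure tensor of a function of the row and a function of the column. -/
def gridTensor (u : Finset.Ico 1 e → K) (w : Finset.Ico 1 d → K) : VanCycle e d → K :=
  fun δ => u δ.1 * w δ.2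

lemma rowAdj_mulVec_gridTensor (u : Finset.Ico 1 e → K) (w : Finset.Ico 1 d → K) :
    (rowAdj K e d).mulVec (gridTensor u w) = gridTensor ((pathAdj K e).mulVec u) w := by
  ext δ
  rw [rowAdj_mulVec]
  simp only [gridTensor, Matrix.mulVec, dotProduct, Finset.sum_mul, mul_assoc]

lemma colAdj_mulVec_gridTensor (u : Finset.Ico 1 e → K) (w : Finset.Ico 1 d → K) :
    (colAdj K e d).mulVec (gridTensor u w) = gridTensor u ((pathAdj K d).mulVec w) := by
  ext δ
  rw [colAdj_mulVec]
  simp only [gridTensor, Matrix.mulVec, dotProduct, Finset.mul_sum, mul_left_comm]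

lemma cycleVec_eq_gridTensor (δ : VanCycle e d) :
    cycleVec K δ = gridTensor (Pi.single δ.1 1) (foldVec K d d δ.col) := by
  have := foldVec_self (K := K) δ.2
  change foldVec K d d δ.col = _ at this
  rw [this]
  ext δ'
  simp only [cycleVec, gridTensor, Pi.single_apply, Prod.ext_iff, mul_ite, mul_one, mul_zero]
  split_ifs <;> simp_all

end

/-! ### Spectrum of a path. -/

lemma pathAdj_mulVec_sin {n : ℕ} {α : ℂ} (hα : Complex.sin (n * α) = 0) :
    (pathAdj ℂ n).mulVec (fun k => Complex.sin ((k : ℕ) * α)) =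
      (2 * Complex.cos α) • fun k : Finset.Ico 1 n => Complex.sin ((k : ℕ) * α) := by
  ext k
  have hk := Finset.mem_Ico.1 k.2
  rw [pathAdj_mulVec (g := fun k : ℕ => Complex.sin (k * α)) (by simp) hα, Pi.smul_apply,
    smul_eq_mul, Nat.cast_sub hk.1]
  push_cast
  rw [sub_mul, add_mul, one_mul, Complex.sin_sub, Complex.sin_add]
  ring

/-- The eigenvalues of a path are `2 cos (k π / n)`. -/
lemma exists_cos_of_pathAdj_mulVec {n : ℕ} {y : ℂ} {v : Finset.Ico 1 n → ℂ} (hv : v ≠ 0)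
    (h : (pathAdj ℂ n).mulVec v = y • v) :
    ∃ k : ℕ, 1 ≤ k ∧ k ≤ n - 1 ∧ y = 2 * Complex.cos (k * Real.pi / n) := by
  set g : ℕ → ℂ := fun k => if hk : k ∈ Finset.Ico 1 n then v ⟨k, hk⟩ else 0 with hg
  have gv : (fun a : Finset.Ico 1 n => g a) = v := by
    ext a; simp only [hg]; rw [dif_pos a.2]
  have g0 : g 0 = 0 := by simp [hg]
  have gn : g n = 0 := by simp [hg]
  have hrec : ∀ k, k + 1 < n → g (k + 2) = y * g (k + 1) - g k := by
    intro k hk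
    have h1 := pathAdj_mulVec g0 gn ⟨k + 1, Finset.mem_Ico.2 ⟨by omega, hk⟩⟩
    rw [gv, h, Pi.smul_apply, smul_eq_mul, ← gv] at h1
    simp only [Nat.add_sub_cancel] at h1
    rw [h1]; ring
  have n0 : 1 < n := by
    by_contra hn
    apply hv
    ext a
    have := Finset.mem_Ico.1 a.2
    omega
  have g1 : g 1 ≠ 0 := by
    intro h1
    have : ∀ k, (k ≤ n → g k = 0) ∧ (k + 1 ≤ n → g (k + 1) = 0) := by
      intro k
      induction k with
      | zero => exact ⟨fun _ => g0, fun _ => h1⟩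
      | succ k ih =>
        refine ⟨ih.2, fun hk => ?_⟩
        rw [hrec k (by omega), ih.2 (by omega), ih.1 (by omega)]; ring
    apply hv
    rw [← gv]
    ext a
    exact (this a).1 (Finset.mem_Ico.1 a.2).2.le
  obtain ⟨z, hz⟩ := IsAlgClosed.exists_eval₂_eq_zero (RingHom.id ℂ)
    (Polynomial.X ^ 2 - Polynomial.C y * Polynomial.X + 1 : Polynomial ℂ) (by
      have : (Polynomial.X ^ 2 - Polynomial.C y * Polynomial.X + 1 : Polynomial ℂ).degree = 2 := by
        compute_degree!
      rw [this]; norm_num)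
  simp at hz
  have z0 : z ≠ 0 := by rintro rfl; simp at hz
  have zy : y = z + z⁻¹ := by
    field_simp; linear_combination -hz
  -- Extended by zero at both ends, the eigenvector solves a two-term recurrence with characteristic
  -- roots `z` and `z⁻¹`. The end condition at `n` then makes `z` a `2n`-th root of unity.
  have form : ∀ k, (k ≤ n → g k * (z - z⁻¹) = g 1 * (z ^ k - z⁻¹ ^ k)) ∧
      (k + 1 ≤ n → g (k + 1) * (z - z⁻¹) = g 1 * (z ^ (k + 1) - z⁻¹ ^ (k + 1))) := by
    intro k
    induction k with
    | zero => simp [g0]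
    | succ k ih =>
      refine ⟨ih.2, fun hk => ?_⟩
      rw [hrec k (by omega), sub_mul, mul_assoc, ih.2 (by omega), ih.1 (by omega), zy]
      have : z * z⁻¹ = 1 := mul_inv_cancel₀ z0
      linear_combination g 1 * (z ^ k - z⁻¹ ^ k) * this
  -- With a double root the solution is `k z ^ (k - 1) g 1`, which cannot vanish at `n`.
  have zne : z - z⁻¹ ≠ 0 := by
    intro hz'
    have hzz : z⁻¹ = z := (sub_eq_zero.1 hz').symm
    have z2 : z * z = 1 := by
      nth_rw 1 [← hzz]; exact inv_mul_cancel₀ z0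
    have : ∀ k, (k ≤ n → g k * z = k * z ^ k * g 1) ∧
        (k + 1 ≤ n → g (k + 1) * z = (k + 1 : ℕ) * z ^ (k + 1) * g 1) := by
      intro k
      induction k with
      | zero => simp [g0, mul_comm]
      | succ k ih =>
        refine ⟨ih.2, fun hk => ?_⟩
        rw [hrec k (by omega), sub_mul, mul_assoc, ih.2 (by omega), ih.1 (by omega), zy, hzz]
        push_cast
        linear_combination (k * z ^ k * g 1) * z2
    have := (this n).1 le_rfl
    rw [gn, zero_mul, eq_comm, mul_eq_zero, mul_eq_zero] at this
    rcases this with (h | h) | h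
    · exact (Nat.cast_ne_zero.2 (by omega)) h
    · exact pow_ne_zero _ z0 h
    · exact g1 h
  have zn : z ^ (2 * n) = 1 := by
    have h1 := (form n).1 le_rfl
    rw [gn, zero_mul, eq_comm, mul_eq_zero, or_iff_right g1, inv_pow] at h1
    have : z ^ n ≠ 0 := pow_ne_zero _ z0
    field_simp at h1
    rw [mul_comm, pow_mul]
    linear_combination h1
  have : NeZero (2 * n) := ⟨by omega⟩
  have hprim := Complex.isPrimitiveRoot_exp (2 * n) (by omega)
  obtain ⟨j, hj, rfl⟩ := hprim.eq_pow_of_pow_eq_one zn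
  have nC : (n : ℂ) ≠ 0 := Nat.cast_ne_zero.2 (by omega)
  have ex : Complex.exp (2 * Real.pi * Complex.I / (2 * n : ℕ)) ^ j =
      Complex.exp ((j * Real.pi / n : ℂ) * Complex.I) := by
    rw [← Complex.exp_nat_mul]
    congr 1
    push_cast
    field_simp
  rw [ex, ← Complex.exp_neg] at zy zne
  rw [← neg_mul] at zy zne
  have yc : y = 2 * Complex.cos (j * Real.pi / n) := by
    rw [zy, Complex.two_cos]
  have sne : Complex.sin (j * Real.pi / n) ≠ 0 := by
    intro hs
    apply zne
    have := Complex.two_sin (j * Real.pi / n : ℂ)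
    rw [hs] at this
    have I0 := Complex.I_ne_zero
    have h2 := (mul_eq_zero.1 (this.symm.trans (mul_zero 2))).resolve_right I0
    linear_combination -h2
  have j0 : j ≠ 0 := by rintro rfl; simp at sne
  have jn : j ≠ n := by
    rintro rfl
    apply sne
    rw [mul_div_cancel_left₀ _ nC, Complex.sin_pi]
  rcases lt_or_gt_of_ne jn with hlt | hgt
  · exact ⟨j, by omega, by omega, yc⟩
  · refine ⟨2 * n - j, by omega, by omega, ?_⟩
    rw [yc, Nat.cast_sub hj.le]
    congr 1
    have : (((2 * n : ℕ) : ℂ) - j) * Real.pi / n = 2 * Real.pi - j * Real.pi / n := by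
      push_cast; field_simp
    rw [this, Complex.cos_two_pi_sub]

/-! ### Stability of `Mon(δ)` and upper bounds for it. -/

section
variable (K : Type*) [Field K] (e d : ℕ)

/-- `rowAdj` as an endomorphism. -/
def rowEnd : Module.End K (VanCycle e d → K) := Matrix.toLinAlgEquiv' (rowAdj K e d)

/-- `colAdj` as an endomorphism. -/
def colEnd : Module.End K (VanCycle e d → K) := Matrix.toLinAlgEquiv' (colAdj K e d)

/-- `rowSign` as an endomorphism. -/
def rowSgn : Module.End K (VanCycle e d → K) := Matrix.toLinAlgEquiv' (rowSign K e d)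

/-- `colSign` as an endomorphism. -/
def colSgn : Module.End K (VanCycle e d → K) := Matrix.toLinAlgEquiv' (colSign K e d)

/-- The variation of the monodromy as an endomorphism. -/
def varEnd : Module.End K (VanCycle e d → K) :=
  gridVar K (rowEnd K e d) (colEnd K e d) (rowSgn K e d) (colSgn K e d)

lemma isGrid_end : IsGrid (rowEnd K e d) (colEnd K e d) (rowSgn K e d) (colSgn K e d) :=
  (isGrid_matrix K e d).map (Matrix.toLinAlgEquiv' (R := K) (n := VanCycle e d)).toRingEquiv.toRingHom

variable {e d}

lemma toLinAlgEquiv'_monodromyMatrix [CharZero K] :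
    Matrix.toLinAlgEquiv' (monodromyMatrix K e d) = 1 + varEnd K e d := by
  simp only [monodromyMatrix_eq, varEnd, gridVar, rowEnd, colEnd, rowSgn, colSgn, map_add, map_sub,
    map_mul, map_smul, map_one]

lemma monodromyMatrix_mulVec [CharZero K] (v : VanCycle e d → K) :
    (monodromyMatrix K e d).mulVec v = v + varEnd K e d v := by
  rw [← Matrix.toLinAlgEquiv'_apply, toLinAlgEquiv'_monodromyMatrix]; rfl

lemma cycleVec_mem_Mon (δ : VanCycle e d) : cycleVec K δ ∈ Mon K δ := by
  refine Submodule.subset_span ⟨0, ?_, by simp⟩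
  have h1 := Finset.mem_Ico.1 δ.1.2
  have h2 := Finset.mem_Ico.1 δ.2.2
  exact Nat.mul_pos (by omega) (by omega)

lemma card_vanCycle (e d : ℕ) : Fintype.card (VanCycle e d) = (e - 1) * (d - 1) := by
  simp

/-- By Cayley–Hamilton every power of `M_e` reduces to the first `N` powers, so truncating the orbit
does not change its span. -/
lemma pow_mulVec_mem_Mon (δ : VanCycle e d) (k : ℕ) :
    (monodromyMatrix K e d ^ k).mulVec (cycleVec K δ) ∈ Mon K δ := by
  set M := monodromyMatrix K e d
  have hdeg : M.charpoly.natDegree = (e - 1) * (d - 1) := by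
    rw [Matrix.charpoly_natDegree_eq_dim, card_vanCycle]
  have hne : M.charpoly ≠ 1 := by
    intro h
    rw [h, Polynomial.natDegree_one] at hdeg
    have h1 := Finset.mem_Ico.1 δ.1.2
    have h2 := Finset.mem_Ico.1 δ.2.2
    have : 0 < (e - 1) * (d - 1) := Nat.mul_pos (by omega) (by omega)
    omega
  rw [Matrix.pow_eq_aeval_mod_charpoly, Polynomial.aeval_eq_sum_range'
    (n := (e - 1) * (d - 1)) (hdeg ▸ Polynomial.natDegree_modByMonic_lt _
      M.charpoly_monic hne), Matrix.sum_mulVec]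
  refine Submodule.sum_mem _ fun i hi => ?_
  rw [Matrix.smul_mulVec]
  exact Submodule.smul_mem _ _ (Submodule.subset_span ⟨i, Finset.mem_range.1 hi, rfl⟩)

lemma varEnd_mem_Mon [CharZero K] (δ : VanCycle e d) :
    ∀ v ∈ Mon K δ, varEnd K e d v ∈ Mon K δ := by
  suffices h : Mon K δ ≤ (Mon K δ).comap (Matrix.toLinAlgEquiv' (monodromyMatrix K e d)) by
    intro v hv
    have := h hv
    rw [Submodule.mem_comap, toLinAlgEquiv'_monodromyMatrix] at this
    exact ((Mon K δ).add_mem_iff_right hv).1 this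
  conv_lhs => rw [Mon]
  rw [Submodule.span_le]
  rintro _ ⟨l, -, rfl⟩
  change Matrix.toLinAlgEquiv' _ _ ∈ Mon K δ
  rw [Matrix.toLinAlgEquiv'_apply, Matrix.mulVec_mulVec, ← pow_succ']
  exact pow_mulVec_mem_Mon K δ _

/-- A subspace stable under the grid operators is stable under the monodromy. -/
lemma Mon_le [CharZero K] {δ : VanCycle e d} {S : Submodule K (VanCycle e d → K)}
    (hδ : cycleVec K δ ∈ S) (hp : ∀ v ∈ S, rowEnd K e d v ∈ S) (hq : ∀ v ∈ S, colEnd K e d v ∈ S)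
    (hs : ∀ v ∈ S, rowSgn K e d v ∈ S) (ht : ∀ v ∈ S, colSgn K e d v ∈ S) : Mon K δ ≤ S := by
  have hM : ∀ v ∈ S, (monodromyMatrix K e d).mulVec v ∈ S := by
    intro v hv
    rw [monodromyMatrix_mulVec, varEnd, IsGrid.gridVar_apply]
    exact S.add_mem hv (S.sub_mem (S.add_mem (hp _ (hs _ hv)) (hq _ (ht _ hv)))
      (S.smul_mem _ (S.add_mem (hp _ (hq _ (hs _ hv))) (hp _ (hq _ (ht _ hv))))))
  rw [Mon, Submodule.span_le]
  rintro _ ⟨l, -, rfl⟩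
  induction l with
  | zero => simpa using hδ
  | succ l ih =>
    rw [pow_succ', ← Matrix.mulVec_mulVec]
    exact hM _ ih

/-- Each row is orthogonal to all the odd functions of period `2 r`. -/
def foldOrthogonal (e d r : ℕ) : Submodule K (VanCycle e d → K) where
  carrier := {v | ∀ a m, foldVec K d r m ⬝ᵥ (fun k => v (a, k)) = 0}
  add_mem' := by
    intro v w hv hw a m
    have := dotProduct_add (foldVec K d r m) (fun k => v (a, k)) (fun k => w (a, k))
    rw [hv a m, hw a m, add_zero] at this
    exact this
  zero_mem' := fun a m => dotProduct_zero _
  smul_mem' := by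
    intro c v hv a m
    have := dotProduct_smul c (foldVec K d r m) (fun k => v (a, k))
    rw [hv a m, smul_zero] at this
    exact this

/-- Odd `2r`-periodic functions vanish at multiples of `r`, in particular at the column of `δ`. The
family is stable under adjacency, which shifts `m` by `±1`, and each member lives on a single
parity. -/
lemma Mon_le_foldOrthogonal [CharZero K] (δ : VanCycle e d) :
    Mon K δ ≤ foldOrthogonal K e d (Nat.gcd d δ.col) := by
  set r := Nat.gcd d δ.col with hr
  apply Mon_le
  · intro a m
    have hz : foldVec K d r m δ.2 = 0 := by
      have : (2 * r : ℤ) ∣ (δ.2 : ℕ) - m ↔ (2 * r : ℤ) ∣ (δ.2 : ℕ) + m := by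
        have h2 : (2 * r : ℤ) ∣ ((δ.2 : ℕ) + m) + ((δ.2 : ℕ) - m) := by
          rw [show (((δ.2 : ℕ) : ℤ) + m) + ((δ.2 : ℕ) - m) = 2 * (δ.2 : ℕ) by ring]
          exact mul_dvd_mul_left 2 (Int.natCast_dvd_natCast.2 (Nat.gcd_dvd_right d δ.col))
        exact ⟨fun h => (dvd_add_left h).1 h2, fun h => (dvd_add_right h).1 h2⟩
      simp only [foldVec, this, sub_self]
    refine Finset.sum_eq_zero fun k _ => ?_
    by_cases h : (a, k) = δ
    · rw [← h] at hz
      rw [hz, zero_mul]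
    · have : cycleVec K δ (a, k) = 0 := Pi.single_eq_of_ne h _
      exact mul_eq_zero_of_right _ this
  · intro v hv a m
    have : (fun k => rowEnd K e d v (a, k)) = ∑ a', pathAdj K e a a' • fun k => v (a', k) := by
      ext k
      rw [rowEnd, Matrix.toLinAlgEquiv'_apply, rowAdj_mulVec]
      simp [Matrix.mulVec, dotProduct]
    rw [this, dotProduct_sum]
    refine Finset.sum_eq_zero fun a' _ => ?_
    rw [dotProduct_smul, hv a' m, smul_zero]
  · intro v hv a m
    have : (fun k => colEnd K e d v (a, k)) = (pathAdj K d).mulVec fun k => v (a, k) := by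
      ext k
      rw [colEnd, Matrix.toLinAlgEquiv'_apply, colAdj_mulVec]
    have ht : (pathAdj K d).transpose = pathAdj K d := by
      ext; exact pathAdj_apply_comm K d _ _
    rw [this, Matrix.dotProduct_mulVec, ← ht, Matrix.vecMul_transpose,
      pathAdj_mulVec_foldVec (Nat.gcd_dvd_left d δ.col), add_dotProduct, hv a _, hv a _, add_zero]
  · intro v hv a m
    have : (fun k => rowSgn K e d v (a, k)) = (-1 : K) ^ (a : ℕ) • fun k => v (a, k) := by
      ext k
      rw [rowSgn, Matrix.toLinAlgEquiv'_apply, rowSign_mulVec]; rfl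
    rw [this, dotProduct_smul, hv a m, smul_zero]
  · intro v hv a m
    have hc : ∃ c : K, ∀ k, foldVec K d r m k * (-1) ^ (k : ℕ) = c * foldVec K d r m k := by
      refine ⟨if Even m then 1 else -1, fun k => ?_⟩
      by_cases hk : foldVec K d r m k = 0
      · rw [hk, zero_mul, mul_zero]
      · have : Even (k : ℕ) ↔ Even m := by
          simp only [foldVec] at hk
          have hk' : (2 * r : ℤ) ∣ (k : ℕ) - m ∨ (2 * r : ℤ) ∣ (k : ℕ) + m := by
            by_contra! h
            simp [h.1, h.2] at hk
          have h2 : (2 : ℤ) ∣ (k : ℕ) - m ∨ (2 : ℤ) ∣ (k : ℕ) + m :=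
            hk'.imp (dvd_trans (dvd_mul_right _ _)) (dvd_trans (dvd_mul_right _ _))
          rw [← Int.even_coe_nat]
          rcases h2 with h | h
          · exact Int.even_sub.1 (even_iff_two_dvd.2 h)
          · exact Int.even_add.1 (even_iff_two_dvd.2 h)
        split_ifs with hm
        · rw [(this.2 hm).neg_one_pow, mul_comm]
        · rw [(Nat.not_even_iff_odd.1 (fun h => hm (this.1 h))).neg_one_pow, mul_comm]
    obtain ⟨c, hc⟩ := hc
    have h0 : c * (foldVec K d r m ⬝ᵥ fun k => v (a, k)) = 0 := by rw [hv a m, mul_zero]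
    rw [← h0, dotProduct, dotProduct, Finset.mul_sum]
    refine Finset.sum_congr rfl fun k _ => ?_
    rw [colSgn, Matrix.toLinAlgEquiv'_apply, colSign_mulVec, ← mul_assoc, ← mul_assoc]
    exact congrArg (· * v (a, k)) (hc k)

/-- The columns of the cycles in `Mon(δ)` are multiples of `gcd(d, δ.col)`. -/
theorem gcd_dvd_col_of_mem_Mon [CharZero K] {δ δ' : VanCycle e d} (h : cycleVec K δ' ∈ Mon K δ) :
    Nat.gcd d δ.col ∣ δ'.col := by
  -- Testing against the function centred at the column of `δ'` gives `1 - [2r ∣ 2 δ'.col] = 0`.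
  have := Mon_le_foldOrthogonal K δ h δ'.1 δ'.col
  rw [dotProduct, Finset.sum_eq_single δ'.2] at this
  · rw [show ((δ'.1, δ'.2) : VanCycle e d) = δ' from rfl, cycleVec, Pi.single_eq_same, mul_one,
      foldVec] at this
    change (if _ ∣ (δ'.col : ℤ) - δ'.col then (1 : K) else 0) -
      (if _ ∣ (δ'.col : ℤ) + δ'.col then 1 else 0) = 0 at this
    rw [sub_self, if_pos (dvd_zero _), ← two_mul] at this
    by_contra hn
    rw [if_neg] at this
    · simp at this
    · rwa [mul_dvd_mul_iff_left two_ne_zero, Int.natCast_dvd_natCast]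
  · intro k _ hk
    rw [cycleVec, Pi.single_eq_of_ne, mul_zero]
    intro h
    exact hk (congrArg Prod.snd h)
  · simp

/-- The monodromy of `y ^ 4 + x ^ d` preserves the symmetry of the rows. -/
theorem row_eq_two_of_mem_Mon [CharZero K] {δ δ' : VanCycle 4 d} (hδ : δ.row = 2)
    (h : cycleVec K δ' ∈ Mon K δ) : δ'.row = 2 := by
  set a₁ : Finset.Ico 1 4 := ⟨1, by decide⟩ with ha₁
  set a₂ : Finset.Ico 1 4 := ⟨2, by decide⟩ with ha₂
  set a₃ : Finset.Ico 1 4 := ⟨3, by decide⟩ with ha₃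
  have rows : ∀ δ : VanCycle 4 d, δ.row = 1 ∧ δ.1 = a₁ ∨ δ.row = 2 ∧ δ.1 = a₂ ∨
      δ.row = 3 ∧ δ.1 = a₃ := by
    intro δ
    simp only [Subtype.ext_iff, ha₁, ha₂, ha₃, VanCycle.row]
    have := Finset.mem_Ico.1 δ.1.2
    omega
  -- Rows 1 and 3 have the same only neighbour and the same parity, so equality of the two rows is
  -- preserved by all grid operators.
  let S : Submodule K (VanCycle 4 d → K) :=
    { carrier := {v | ∀ k, v (a₁, k) = v (a₃, k)}
      add_mem' := fun hv hw k => congrArg₂ (· + ·) (hv k) (hw k)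
      zero_mem' := fun _ => rfl
      smul_mem' := fun c v hv k => congrArg (c * ·) (hv k) }
  have hle : Mon K δ ≤ S := by
    apply Mon_le
    · intro k
      rw [cycleVec, Pi.single_eq_of_ne, Pi.single_eq_of_ne]
      · rintro rfl; exact absurd (show 3 = 2 from hδ) (by decide)
      · rintro rfl; exact absurd (show 1 = 2 from hδ) (by decide)
    · intro v _ k
      rw [rowEnd, Matrix.toLinAlgEquiv'_apply, rowAdj_mulVec, rowAdj_mulVec]
      change ∑ b, pathAdj K 4 a₁ b * v (b, k) = ∑ b, pathAdj K 4 a₃ b * v (b, k)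
      refine Finset.sum_congr rfl fun b _ => ?_
      congr 1
      have hb := Finset.mem_Ico.1 b.2
      simp only [pathAdj, Matrix.of_apply, ha₁, ha₃]
      exact if_congr (by omega) rfl rfl
    · intro v hv k
      rw [colEnd, Matrix.toLinAlgEquiv'_apply, colAdj_mulVec, colAdj_mulVec]
      congr 2
      ext b
      exact hv b
    · intro v hv k
      rw [rowSgn, Matrix.toLinAlgEquiv'_apply, rowSign_mulVec, rowSign_mulVec, hv k]
      congr 1
      change (-1 : K) ^ 1 = (-1) ^ 3
      norm_num
    · intro v hv k
      rw [colSgn, Matrix.toLinAlgEquiv'_apply, colSign_mulVec, colSign_mulVec, hv k]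
      rfl
  have hS := hle h δ'.2
  rcases rows δ' with ⟨-, h⟩ | ⟨h, -⟩ | ⟨-, h⟩
  · rw [cycleVec, ← h, show ((δ'.1, δ'.2) : VanCycle 4 d) = δ' from rfl, Pi.single_eq_same,
      Pi.single_eq_of_ne] at hS
    · simp at hS
    · intro h'
      have := congrArg Prod.fst h'
      rw [h] at this
      exact absurd (congrArg Subtype.val this) (show ¬ 3 = 1 by decide)
  · exact h
  · rw [cycleVec, ← h, show ((δ'.1, δ'.2) : VanCycle 4 d) = δ' from rfl, Pi.single_eq_same,
      Pi.single_eq_of_ne] at hS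
    · simp at hS
    · intro h'
      have := congrArg Prod.fst h'
      rw [h] at this
      exact absurd (congrArg Subtype.val this) (show ¬ 1 = 3 by decide)

end

/-! ### Reflections, the Chebyshev recurrence and the lower bound. -/

/-- A set of integers closed under point reflections contains, with `0`, `d` and `j`, all multiples of
`gcd d j`. -/
lemma mem_of_gcd_dvd_of_reflect {G : Set ℤ} (hG : ∀ m ∈ G, ∀ n ∈ G, 2 * m - n ∈ G) {d j : ℕ}
    (hd : d ≠ 0) (h0 : 0 ∈ G) (hdG : (d : ℤ) ∈ G) (hjG : (j : ℤ) ∈ G) {n : ℤ}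
    (hn : (Nat.gcd d j : ℤ) ∣ n) : n ∈ G := by
  have neg : ∀ m ∈ G, -m ∈ G := fun m hm => by simpa using hG 0 h0 m hm
  have add : ∀ m ∈ G, ∀ n ∈ G, n + 2 * m ∈ G := fun m hm n hn => by
    simpa [add_comm] using hG m hm _ (neg n hn)
  have tr : ∀ m ∈ G, ∀ n ∈ G, ∀ z : ℤ, n + 2 * m * z ∈ G := by
    intro m hm n hn z
    induction z using Int.induction_on with
    | zero => simpa using hn
    | succ z ih =>
      have := add m hm _ ih
      rwa [show n + 2 * m * z + 2 * m = n + 2 * m * (z + 1) by ring] at this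
    | pred z ih =>
      have := add _ (neg m hm) _ ih
      rwa [show n + 2 * m * (-z) + 2 * -m = n + 2 * m * (-z - 1) by ring] at this
  -- Two reflections compose to a translation by an even multiple, so only combinations with both
  -- coefficients odd are out of direct reach.
  have base : ∀ α β : ℤ, ¬ (Odd α ∧ Odd β) → d * α + j * β ∈ G := by
    intro α β h
    rcases Int.even_or_odd' α with ⟨x, rfl | rfl⟩
    · have := fun n hn => tr d hdG n hn x
      rcases Int.even_or_odd' β with ⟨y, rfl | rfl⟩
      · have := this _ (tr j hjG 0 h0 y)
        rwa [show (0 : ℤ) + 2 * j * y + 2 * d * x = d * (2 * x) + j * (2 * y) by ring] at this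
      · have := this _ (tr j hjG j hjG y)
        rwa [show (j : ℤ) + 2 * j * y + 2 * d * x = d * (2 * x) + j * (2 * y + 1) by ring] at this
    · rcases Int.even_or_odd' β with ⟨y, rfl | rfl⟩
      · have := tr j hjG _ (tr d hdG d hdG x) y
        rwa [show (d : ℤ) + 2 * d * x + 2 * j * y = d * (2 * x + 1) + j * (2 * y) by ring] at this
      · exact absurd ⟨⟨x, rfl⟩, ⟨y, rfl⟩⟩ h
  obtain ⟨c, rfl⟩ := hn
  have bez : (Nat.gcd d j : ℤ) * c = d * (Nat.gcdA d j * c) + j * (Nat.gcdB d j * c) := by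
    rw [Nat.gcd_eq_gcd_ab]; ring
  rw [bez]
  generalize Nat.gcdA d j * c = α
  generalize Nat.gcdB d j * c = β
  obtain ⟨d', hd'⟩ := Nat.gcd_dvd_left d j
  obtain ⟨j', hj'⟩ := Nat.gcd_dvd_right d j
  have hcop : Nat.Coprime d' j' := by
    have hpos : 0 < Nat.gcd d j := Nat.gcd_pos_of_pos_left _ (Nat.pos_of_ne_zero hd)
    have := Nat.coprime_div_gcd_div_gcd hpos
    rwa [Nat.div_eq_of_eq_mul_right hpos hd', Nat.div_eq_of_eq_mul_right hpos hj'] at this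
  by_cases hodd : Odd α ∧ Odd β
  · have e : (d : ℤ) * α + j * β = d * (α + j') + j * (β - d') := by
      have : (d : ℤ) * j' = j * d' := by
        have h1 : (d : ℤ) = Nat.gcd d j * d' := by exact_mod_cast hd'
        have h2 : (j : ℤ) = Nat.gcd d j * j' := by exact_mod_cast hj'
        linear_combination j' * h1 - d' * h2
      linear_combination -this
    rw [e]
    apply base
    rintro ⟨h1, h2⟩
    have e1 : Even (j' : ℤ) := by
      have := h1.sub_odd hodd.1
      rwa [add_sub_cancel_left] at this
    have e2 : Even (d' : ℤ) := by
      have := hodd.2.sub_odd h2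
      rwa [sub_sub_cancel] at this
    have := Nat.dvd_gcd (even_iff_two_dvd.1 ((Int.even_coe_nat _).1 e2))
      (even_iff_two_dvd.1 ((Int.even_coe_nat _).1 e1))
    rw [hcop] at this
    omega
  · exact base α β hodd

/-- The sums `F (m + k) + F (m - k)` obey a three-term recurrence in `k` under `A`, so all lie in
`S` once `F m` does; if also `F n ∈ S`, then so is `F (2m - n)`. `A` is required to preserve
membership only for single vectors and symmetric sums, since these have definite parity in the
application. -/
lemma mem_of_gcd_dvd_of_chebyshev {K V : Type*} [Field K] [AddCommGroup V] [Module K V]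
    {S : Submodule K V} {A : Module.End K V} {F : ℤ → V} (hA : ∀ m, A (F m) = F (m - 1) + F (m + 1))
    (hstep : ∀ m k, F (m + k) + F (m - k) ∈ S → A (F (m + k) + F (m - k)) ∈ S)
    (hstep' : ∀ m, F m ∈ S → A (F m) ∈ S) {d j : ℕ} (hd : d ≠ 0) (h0 : F 0 = 0) (hFd : F d = 0)
    (hj : F j ∈ S) {n : ℤ} (hn : (Nat.gcd d j : ℤ) ∣ n) : F n ∈ S := by
  refine mem_of_gcd_dvd_of_reflect (G := {m | F m ∈ S}) ?_ hd (by simp [h0]) (by simp [hFd]) hj hn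
  intro m hm n hn
  have key : ∀ k : ℕ, F (m + k) + F (m - k) ∈ S ∧ F (m + (k + 1 : ℕ)) + F (m - (k + 1 : ℕ)) ∈ S := by
    intro k
    induction k with
    | zero =>
      refine ⟨by simpa using S.add_mem hm hm, ?_⟩
      have := hstep' m hm
      rw [hA] at this
      simpa [add_comm] using this
    | succ k ih =>
      refine ⟨ih.2, ?_⟩
      have := S.sub_mem (hstep _ _ ih.2) ih.1
      rw [map_add, hA, hA] at this
      push_cast at this ⊢
      rw [show m + ((k : ℤ) + 1) - 1 = m + k by ring, show m - ((k : ℤ) + 1) + 1 = m - k by ring,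
        show m + ((k : ℤ) + 1) + 1 = m + (k + 1 + 1) by ring,
        show m - ((k : ℤ) + 1) - 1 = m - (k + 1 + 1) by ring] at this
      convert this using 1
      abel
  change F (2 * m - n) ∈ S
  rcases Int.le_total n m with h | h
  · have := (key (m - n).toNat).1
    rw [Int.toNat_of_nonneg (by omega), sub_sub_cancel] at this
    rw [show 2 * m - n = m + (m - n) by ring]
    exact (S.add_mem_iff_left hn).1 this
  · have := (key (n - m).toNat).1
    rw [Int.toNat_of_nonneg (by omega), add_sub_cancel] at this
    rw [show 2 * m - n = m - (n - m) by ring]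
    exact (S.add_mem_iff_right hn).1 this

section
variable (K : Type*) [Field K] (e d : ℕ)

/-- The subspace contains the neighbours of its homogeneous vectors. -/
def AdjClosed (S : Submodule K (VanCycle e d → K)) : Prop :=
  ∀ v ∈ S, ∀ c c' : K, (c = 1 ∨ c = -1) → (c' = 1 ∨ c' = -1) → rowSgn K e d v = c • v →
    colSgn K e d v = c' • v → rowEnd K e d v ∈ S ∧ colEnd K e d v ∈ S

/-- The cycles at all integer positions, continued as odd periodic functions. -/
def latticeVec (a m : ℤ) : VanCycle e d → K := gridTensor (foldVec K e e a) (foldVec K d d m)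

/-- The parity sign of an integer. -/
def paritySign (m : ℤ) : K := if Even m then 1 else -1

lemma paritySign_eq (m : ℤ) : paritySign K m = 1 ∨ paritySign K m = -1 := by
  unfold paritySign; split_ifs <;> simp

/-- This makes the symmetric sums of the Chebyshev argument homogeneous. -/
lemma paritySign_add_sub (m k : ℤ) : paritySign K (m + k) = paritySign K (m - k) := by
  simp only [paritySign, Int.even_add, Int.even_sub]

variable {K}

lemma neg_one_pow_mul_foldVec (n : ℕ) (m : ℤ) (k : Finset.Ico 1 n) :
    (-1) ^ (k : ℕ) * foldVec K n n m k = paritySign K m * foldVec K n n m k := by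
  by_cases hk : foldVec K n n m k = 0
  · rw [hk, mul_zero, mul_zero]
  · congr 1
    have : Even (k : ℕ) ↔ Even m := by
      simp only [foldVec] at hk
      have hk' : (2 * n : ℤ) ∣ (k : ℕ) - m ∨ (2 * n : ℤ) ∣ (k : ℕ) + m := by
        by_contra! h
        simp [h.1, h.2] at hk
      have h2 : (2 : ℤ) ∣ (k : ℕ) - m ∨ (2 : ℤ) ∣ (k : ℕ) + m :=
        hk'.imp (dvd_trans (dvd_mul_right _ _)) (dvd_trans (dvd_mul_right _ _))
      rw [← Int.even_coe_nat]
      rcases h2 with h | h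
      · exact Int.even_sub.1 (even_iff_two_dvd.2 h)
      · exact Int.even_add.1 (even_iff_two_dvd.2 h)
    unfold paritySign
    split_ifs with hm
    · exact (this.2 hm).neg_one_pow
    · exact (Nat.not_even_iff_odd.1 (fun h => hm (this.1 h))).neg_one_pow

variable {e d}

lemma rowSgn_latticeVec (a m : ℤ) :
    rowSgn K e d (latticeVec K e d a m) = paritySign K a • latticeVec K e d a m := by
  ext δ
  rw [rowSgn, Matrix.toLinAlgEquiv'_apply, rowSign_mulVec]
  simp only [latticeVec, gridTensor, Pi.smul_apply, smul_eq_mul, ← mul_assoc]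
  congr 1
  exact neg_one_pow_mul_foldVec e a δ.1

lemma colSgn_latticeVec (a m : ℤ) :
    colSgn K e d (latticeVec K e d a m) = paritySign K m • latticeVec K e d a m := by
  ext δ
  rw [colSgn, Matrix.toLinAlgEquiv'_apply, colSign_mulVec]
  simp only [latticeVec, gridTensor, Pi.smul_apply, smul_eq_mul, mul_left_comm _ (foldVec K e e a δ.1)]
  congr 1
  exact neg_one_pow_mul_foldVec d m δ.2

lemma rowEnd_latticeVec (a m : ℤ) : rowEnd K e d (latticeVec K e d a m) =
    latticeVec K e d (a - 1) m + latticeVec K e d (a + 1) m := by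
  rw [rowEnd, Matrix.toLinAlgEquiv'_apply, latticeVec, rowAdj_mulVec_gridTensor,
    pathAdj_mulVec_foldVec dvd_rfl]
  ext δ
  exact add_mul _ _ _

lemma colEnd_latticeVec (a m : ℤ) : colEnd K e d (latticeVec K e d a m) =
    latticeVec K e d a (m - 1) + latticeVec K e d a (m + 1) := by
  rw [colEnd, Matrix.toLinAlgEquiv'_apply, latticeVec, colAdj_mulVec_gridTensor,
    pathAdj_mulVec_foldVec dvd_rfl]
  ext δ
  exact mul_add _ _ _

lemma cycleVec_eq_latticeVec (δ : VanCycle e d) :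
    cycleVec K δ = latticeVec K e d δ.row δ.col := by
  rw [cycleVec_eq_gridTensor, latticeVec, ← foldVec_self]; rfl

/-- A subspace that contains the neighbours of its homogeneous vectors and a cycle contains all
cycles at the multiples of the position of this cycle. -/
theorem AdjClosed.cycleVec_mem {S : Submodule K (VanCycle e d → K)} (hS : AdjClosed K e d S)
    {δ δ' : VanCycle e d} (h : cycleVec K δ ∈ S) (hrow : Nat.gcd e δ.row ∣ δ'.row)
    (hcol : Nat.gcd d δ.col ∣ δ'.col) : cycleVec K δ' ∈ S := by
  have he : e ≠ 0 := by have := Finset.mem_Ico.1 δ.1.2; omega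
  have hd : d ≠ 0 := by have := Finset.mem_Ico.1 δ.2.2; omega
  rw [cycleVec_eq_latticeVec] at h ⊢
  have h1 : latticeVec K e d δ.row δ'.col ∈ S := by
    refine mem_of_gcd_dvd_of_chebyshev (F := fun m => latticeVec K e d δ.row m)
      (fun m => colEnd_latticeVec _ m) (fun m k hm => ?_) (fun m hm => ?_) hd ?_ ?_ h
      (Int.natCast_dvd_natCast.2 hcol)
    · refine (hS _ hm _ _ (paritySign_eq K δ.row) (paritySign_eq K (m - k)) ?_ ?_).2
      · rw [map_add, rowSgn_latticeVec, rowSgn_latticeVec, smul_add]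
      · rw [map_add, colSgn_latticeVec, colSgn_latticeVec, smul_add, paritySign_add_sub]
    · exact (hS _ hm _ _ (paritySign_eq K δ.row) (paritySign_eq K m) (rowSgn_latticeVec _ _)
        (colSgn_latticeVec _ _)).2
    · ext δ; simp [latticeVec, gridTensor, foldVec_zero]
    · ext δ; simp [latticeVec, gridTensor, foldVec_r]
  refine mem_of_gcd_dvd_of_chebyshev (F := fun a => latticeVec K e d a δ'.col)
    (fun m => rowEnd_latticeVec m _) (fun m k hm => ?_) (fun m hm => ?_) he ?_ ?_ h1
    (Int.natCast_dvd_natCast.2 hrow)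
  · refine (hS _ hm _ _ (paritySign_eq K (m - k)) (paritySign_eq K δ'.col) ?_ ?_).1
    · rw [map_add, rowSgn_latticeVec, rowSgn_latticeVec, smul_add, paritySign_add_sub]
    · rw [map_add, colSgn_latticeVec, colSgn_latticeVec, smul_add]
  · exact (hS _ hm _ _ (paritySign_eq K m) (paritySign_eq K δ'.col) (rowSgn_latticeVec _ _)
      (colSgn_latticeVec _ _)).1
  · ext δ; simp [latticeVec, gridTensor, foldVec_zero]
  · ext δ; simp [latticeVec, gridTensor, foldVec_r]

end

/-! ### Short paths, Hermitian structure and spectra over `ℂ`. -/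

lemma pathAdj_two (K : Type*) [Field K] : pathAdj K 2 = 0 := by
  ext ⟨a, ha⟩ ⟨b, hb⟩
  simp only [Finset.mem_Ico] at ha hb
  simp only [pathAdj, Matrix.of_apply, Matrix.zero_apply]
  rw [if_neg (by omega)]

lemma pathAdj_three_sq (K : Type*) [Field K] : pathAdj K 3 * pathAdj K 3 = 1 := by
  ext ⟨a, ha⟩ ⟨b, hb⟩
  rw [Matrix.mul_apply]
  simp only [pathAdj, Matrix.of_apply, Matrix.one_apply, Subtype.mk.injEq]
  rw [Finset.sum_coe_sort (Finset.Ico 1 3) (fun c : ℕ =>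
    (if a + 1 = c ∨ c + 1 = a then (1 : K) else 0) * if c + 1 = b ∨ b + 1 = c then 1 else 0)]
  rw [Finset.mem_Ico] at ha hb
  obtain ⟨ha1, ha2⟩ := ha
  obtain ⟨hb1, hb2⟩ := hb
  interval_cases a <;> interval_cases b <;> simp [Finset.sum_Ico_succ_top]

lemma pathAdj_four_cube (K : Type*) [Field K] :
    pathAdj K 4 * (pathAdj K 4 * pathAdj K 4) = (2 : K) • pathAdj K 4 := by
  have h2 : pathAdj K 4 * pathAdj K 4 = Matrix.of fun a b : Finset.Ico 1 4 =>
      if (a : ℕ) = 2 then (if (b : ℕ) = 2 then 2 else 0) else (if (b : ℕ) = 2 then 0 else 1) := by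
    ext ⟨a, ha⟩ ⟨b, hb⟩
    rw [Matrix.mul_apply]
    simp only [pathAdj, Matrix.of_apply]
    rw [Finset.sum_coe_sort (Finset.Ico 1 4) (fun c : ℕ =>
      (if a + 1 = c ∨ c + 1 = a then (1 : K) else 0) * if c + 1 = b ∨ b + 1 = c then 1 else 0)]
    rw [Finset.mem_Ico] at ha hb
    obtain ⟨ha1, ha2⟩ := ha
    obtain ⟨hb1, hb2⟩ := hb
    interval_cases a <;> interval_cases b <;> simp [Finset.sum_Ico_succ_top]
    norm_num
  rw [h2]
  ext ⟨a, ha⟩ ⟨b, hb⟩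
  rw [Matrix.mul_apply]
  simp only [pathAdj, Matrix.of_apply, Matrix.smul_apply, smul_eq_mul]
  rw [Finset.sum_coe_sort (Finset.Ico 1 4) (fun c : ℕ =>
    (if a + 1 = c ∨ c + 1 = a then (1 : K) else 0) *
      if c = 2 then (if b = 2 then 2 else 0) else (if b = 2 then 0 else 1))]
  rw [Finset.mem_Ico] at ha hb
  obtain ⟨ha1, ha2⟩ := ha
  obtain ⟨hb1, hb2⟩ := hb
  interval_cases a <;> interval_cases b <;> simp [Finset.sum_Ico_succ_top]
  all_goals norm_num

section
variable {e d : ℕ}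

lemma rowEnd_apply_of_sq {c : ℂ} (h : pathAdj ℂ e * pathAdj ℂ e = c • 1) (v : VanCycle e d → ℂ) :
    rowEnd ℂ e d (rowEnd ℂ e d v) = c • v := by
  rw [rowEnd, ← Module.End.mul_apply, ← map_mul, rowAdj, ← Matrix.mul_kronecker_mul, h,
    one_mul, Matrix.smul_kronecker, Matrix.one_kronecker_one, map_smul, map_one]
  rfl

lemma rowEnd_apply_of_cube {c : ℂ} (h : pathAdj ℂ e * (pathAdj ℂ e * pathAdj ℂ e) = c • pathAdj ℂ e)
    (v : VanCycle e d → ℂ) :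
    rowEnd ℂ e d (rowEnd ℂ e d (rowEnd ℂ e d v)) = c • rowEnd ℂ e d v := by
  rw [rowEnd, ← Module.End.mul_apply, ← Module.End.mul_apply, ← map_mul, ← map_mul, rowAdj,
    ← Matrix.mul_kronecker_mul, ← Matrix.mul_kronecker_mul, mul_assoc, h, one_mul, one_mul,
    Matrix.smul_kronecker, map_smul]
  rfl

/-- The eigenvalues of `colEnd`. -/
lemma exists_cos_of_colEnd {y : ℂ} {v : VanCycle e d → ℂ} (hv : v ≠ 0)
    (h : colEnd ℂ e d v = y • v) :
    ∃ k : ℕ, 1 ≤ k ∧ k ≤ d - 1 ∧ y = 2 * Complex.cos (k * Real.pi / d) := by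
  obtain ⟨δ, hδ⟩ := Function.ne_iff.1 hv
  refine exists_cos_of_pathAdj_mulVec (v := fun k => v (δ.1, k)) ?_ ?_
  · intro h0
    exact hδ (congrFun h0 δ.2)
  · ext k
    have := congrFun h (δ.1, k)
    rwa [colEnd, Matrix.toLinAlgEquiv'_apply, colAdj_mulVec] at this

/-- Writing `y = c²`, either `q v + c v` is an eigenvector of `q` for `c`, or it vanishes and `v` is
one for `-c`. Then `η = exp(2πik/d)`. -/
lemma isCosSq_of_colEnd_sq {y : ℂ} {v : VanCycle e d → ℂ} (hv : v ≠ 0)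
    (h : colEnd ℂ e d (colEnd ℂ e d v) = y • v) : IsCosSq d y := by
  obtain ⟨c, rfl⟩ : ∃ c : ℂ, y = c ^ 2 := by
    obtain ⟨c, hc⟩ := IsAlgClosed.exists_pow_nat_eq y two_pos
    exact ⟨c, hc.symm⟩
  have : ∃ c' w, c' ^ 2 = c ^ 2 ∧ w ≠ 0 ∧ colEnd ℂ e d w = c' • w := by
    by_cases hw : colEnd ℂ e d v + c • v = 0
    · exact ⟨-c, v, by ring, hv, by rw [neg_smul]; exact eq_neg_of_add_eq_zero_left hw⟩
    · refine ⟨c, _, rfl, hw, ?_⟩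
      rw [map_add, map_smul, h]
      module
  obtain ⟨c', w, hc, hw, hc'⟩ := this
  obtain ⟨k, hk1, hkd, rfl⟩ := exists_cos_of_colEnd hw hc'
  have d0 : (d : ℂ) ≠ 0 := Nat.cast_ne_zero.2 (by omega)
  refine ⟨Complex.exp (k * Real.pi / d * Complex.I) ^ 2, ?_, ?_⟩
  · rw [← pow_mul, ← Complex.exp_nat_mul, Complex.exp_eq_one_iff]
    refine ⟨k, ?_⟩
    push_cast
    field_simp
  · rw [← hc, Complex.two_cos, neg_mul, Complex.exp_neg]
    have := Complex.exp_ne_zero (k * Real.pi / d * Complex.I)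
    field_simp
    ring

variable (e d)

lemma pathAdj_isHermitian (n : ℕ) : (pathAdj ℂ n).IsHermitian := by
  ext a b
  rw [Matrix.conjTranspose_apply, pathAdj_apply_comm]
  simp only [pathAdj, Matrix.of_apply]
  split_ifs <;> simp

lemma rowAdj_isHermitian : (rowAdj ℂ e d).IsHermitian := by
  rw [Matrix.IsHermitian, rowAdj, Matrix.conjTranspose_kronecker, Matrix.conjTranspose_one,
    (pathAdj_isHermitian e).eq]

lemma colAdj_isHermitian : (colAdj ℂ e d).IsHermitian := by
  rw [Matrix.IsHermitian, colAdj, Matrix.conjTranspose_kronecker, Matrix.conjTranspose_one,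
    (pathAdj_isHermitian d).eq]

lemma rowSign_isHermitian : (rowSign ℂ e d).IsHermitian := by
  rw [rowSign_eq, Matrix.IsHermitian, Matrix.diagonal_conjTranspose]
  congr 1; ext; simp

lemma colSign_isHermitian : (colSign ℂ e d).IsHermitian := by
  rw [colSign_eq, Matrix.IsHermitian, Matrix.diagonal_conjTranspose]
  congr 1; ext; simp

lemma conjTranspose_gridVar :
    (gridVar ℂ (rowAdj ℂ e d) (colAdj ℂ e d) (rowSign ℂ e d) (colSign ℂ e d)).conjTranspose =
      -gridVar ℂ (rowAdj ℂ e d) (colAdj ℂ e d) (rowSign ℂ e d) (colSign ℂ e d) := by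
  have h := isGrid_matrix ℂ e d
  simp only [gridVar, Matrix.conjTranspose_sub, Matrix.conjTranspose_add, Matrix.conjTranspose_mul,
    Matrix.conjTranspose_smul, (rowAdj_isHermitian e d).eq, (colAdj_isHermitian e d).eq,
    (rowSign_isHermitian e d).eq, (colSign_isHermitian e d).eq, mul_add, mul_assoc, h.sp,
    h.tq, h.sq, h.qp', h.tp, mul_neg, neg_mul]
  rw [show star (2⁻¹ : ℂ) = 2⁻¹ by simp]
  module

lemma varEnd_eq : varEnd ℂ e d = Matrix.toLinAlgEquiv'
    (gridVar ℂ (rowAdj ℂ e d) (colAdj ℂ e d) (rowSign ℂ e d) (colSign ℂ e d)) := by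
  simp only [varEnd, gridVar, rowEnd, colEnd, rowSgn, colSgn, map_add, map_sub, map_mul, map_smul]

/-- `T` is skew-Hermitian, so `i T` is Hermitian, and its eigenvalue `μ` corresponds to `-i μ` for
`T`. -/
lemma iSup_eigenspace_varEnd : ⨆ μ, (varEnd ℂ e d).eigenspace μ = ⊤ := by
  have hA : (Complex.I • gridVar ℂ (rowAdj ℂ e d) (colAdj ℂ e d) (rowSign ℂ e d)
      (colSign ℂ e d)).IsHermitian := by
    rw [Matrix.IsHermitian, Matrix.conjTranspose_smul, conjTranspose_gridVar]
    simp
  rw [eq_top_iff, ← hA.iSup_eigenspace_eq_top]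
  refine iSup_le fun μ => le_iSup_of_le (-Complex.I * μ) ?_
  intro v hv
  rw [Module.End.mem_eigenspace_iff] at hv ⊢
  rw [Matrix.toLin'_apply, Matrix.smul_mulVec] at hv
  rw [varEnd_eq, Matrix.toLinAlgEquiv'_apply, mul_smul, ← hv, smul_smul]
  simp

lemma iSup_eigenspace_rowEnd_sq : ⨆ μ, (rowEnd ℂ e d * rowEnd ℂ e d).eigenspace μ = ⊤ := by
  have hA : (rowAdj ℂ e d * rowAdj ℂ e d).IsHermitian := by
    rw [Matrix.IsHermitian, Matrix.conjTranspose_mul, (rowAdj_isHermitian e d).eq]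
  have := hA.iSup_eigenspace_eq_top
  rw [rowEnd, ← map_mul]
  exact this

lemma iSup_eigenspace_colEnd_sq : ⨆ μ, (colEnd ℂ e d * colEnd ℂ e d).eigenspace μ = ⊤ := by
  have hA : (colAdj ℂ e d * colAdj ℂ e d).IsHermitian := by
    rw [Matrix.IsHermitian, Matrix.conjTranspose_mul, (colAdj_isHermitian e d).eq]
  have := hA.iSup_eigenspace_eq_top
  rw [colEnd, ← map_mul]
  exact this

/-- The squares of Hermitian matrices are positive semidefinite, and `4` makes the sum positive
definite. -/
lemma injective_sq_add_sq_add_four :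
    Function.Injective (rowEnd ℂ e d * rowEnd ℂ e d + colEnd ℂ e d * colEnd ℂ e d +
      (4 : ℂ) • (1 : Module.End ℂ (VanCycle e d → ℂ))) := by
  have h1 : (rowAdj ℂ e d * rowAdj ℂ e d).PosSemidef := by
    have := Matrix.posSemidef_conjTranspose_mul_self (rowAdj ℂ e d)
    rwa [(rowAdj_isHermitian e d).eq] at this
  have h2 : (colAdj ℂ e d * colAdj ℂ e d).PosSemidef := by
    have := Matrix.posSemidef_conjTranspose_mul_self (colAdj ℂ e d)
    rwa [(colAdj_isHermitian e d).eq] at this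
  have h3 : ((4 : ℂ) • (1 : Matrix (VanCycle e d) (VanCycle e d) ℂ)).PosDef :=
    Matrix.PosDef.one.smul (by norm_num)
  have h4 := Matrix.mulVec_injective_iff_isUnit.2 (h3.posSemidef_add (h1.add h2)).isUnit
  have : rowEnd ℂ e d * rowEnd ℂ e d + colEnd ℂ e d * colEnd ℂ e d +
      (4 : ℂ) • (1 : Module.End ℂ (VanCycle e d → ℂ)) =
      Matrix.toLinAlgEquiv' (rowAdj ℂ e d * rowAdj ℂ e d + colAdj ℂ e d * colAdj ℂ e d +
        (4 : ℂ) • (1 : Matrix (VanCycle e d) (VanCycle e d) ℂ)) := by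
    simp only [rowEnd, colEnd, map_add, map_mul, map_smul, map_one]
  rw [this]
  exact h4

end

/-- By dimension an injective `f` maps the stable subspace `S` onto itself, so `f v` already has its
preimage in `S`. -/
lemma Submodule.mem_of_injective_of_apply_mem {K V : Type*} [Field K] [AddCommGroup V] [Module K V]
    [FiniteDimensional K V] {f : Module.End K V} (hf : Function.Injective f) {S : Submodule K V}
    (hS : ∀ v ∈ S, f v ∈ S) {v : V} (hv : f v ∈ S) : v ∈ S := by
  have h1 : S.map f = S := by
    apply Submodule.eq_of_le_of_finrank_eq
    · rintro _ ⟨w, hw, rfl⟩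
      exact hS w hw
    · exact (LinearEquiv.finrank_eq (Submodule.equivMapOfInjective f hf S)).symm
  rw [← h1] at hv
  obtain ⟨w, hw, e⟩ := hv
  rwa [← hf e]

/-! ### Closure under neighbours for two, three and four sheets. -/

section
variable {d : ℕ}

/-- Closure of `Mon(δ)` under neighbours, from the separation of the eigenvalues. -/
lemma adjClosed_Mon {e : ℕ} {x₀ : ℂ}
    (hp : ∀ v : VanCycle e d → ℂ,
      rowEnd ℂ e d (rowEnd ℂ e d (rowEnd ℂ e d v)) = x₀ • rowEnd ℂ e d v)
    (hx₀ : ¬ IsCosSq d x₀)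
    (hu : ∀ x y x' y' l : ℂ, ∀ v v' : VanCycle e d → ℂ, v ≠ 0 → v' ≠ 0 →
      rowEnd ℂ e d (rowEnd ℂ e d v) = x • v → rowEnd ℂ e d (rowEnd ℂ e d v') = x' • v' →
      IsCosSq d y → IsCosSq d y' →
      l ^ 2 + x ^ 2 + y ^ 2 - 2 * x * y - 2 * x * l - 2 * y * l - x * y * l = 0 →
      l ^ 2 + x' ^ 2 + y' ^ 2 - 2 * x' * y' - 2 * x' * l - 2 * y' * l - x' * y' * l = 0 →
      x = x' ∧ y = y') (δ : VanCycle e d) : AdjClosed ℂ e d (Mon ℂ δ) := by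
  have h := isGrid_end ℂ e d
  have hT := varEnd_mem_Mon ℂ δ
  have hXY : ∀ v ∈ Mon ℂ δ, (rowEnd ℂ e d * rowEnd ℂ e d) v ∈ Mon ℂ δ ∧
      (colEnd ℂ e d * colEnd ℂ e d) v ∈ Mon ℂ δ := by
    refine mem_of_joint_eigenvalues (iSup_eigenspace_varEnd e d) (iSup_eigenspace_rowEnd_sq e d)
      (iSup_eigenspace_colEnd_sq e d) h.gridVar_commute_row h.gridVar_commute_col ?_ ?_ hT
    · simp only [mul_assoc, h.qp, h.qp']
    · intro l x y x' y' v v' hv hv' h1 h2 h3 h1' h2' h3'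
      exact hu x y x' y' (-l ^ 2) v v' hv hv' h2 h2' (isCosSq_of_colEnd_sq hv h3)
        (isCosSq_of_colEnd_sq hv' h3') (h.eigenvalue_relation hv h1 h2 h3)
        (h.eigenvalue_relation hv' h1' h2' h3')
  have hX := fun v hv => (hXY v hv).1
  have hY := fun v hv => (hXY v hv).2
  intro v hv c c' hc hc' hs ht
  refine h.adj_mem (Mon ℂ δ) hT hX hY ?_ hp ?_ hv hc hc' hs ht
  · intro w hw
    refine Submodule.mem_of_injective_of_apply_mem (injective_sq_add_sq_add_four e d) ?_ hw
    intro u hu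
    exact Submodule.add_mem _ (Submodule.add_mem _ (hX u hu) (hY u hu)) (Submodule.smul_mem _ _ hu)
  · intro w hw
    refine Submodule.mem_of_injective_of_apply_mem
      (f := colEnd ℂ e d * colEnd ℂ e d - x₀ • 1) ?_ ?_ hw
    · rw [← LinearMap.ker_eq_bot, LinearMap.ker_eq_bot']
      intro u hu
      by_contra h0
      exact hx₀ (isCosSq_of_colEnd_sq h0 (sub_eq_zero.1 hu))
    · intro u hu
      exact Submodule.sub_mem _ (hY u hu) (Submodule.smul_mem _ _ hu)

/-- With a single row `p = 0` and `T = q t`, so on vectors of definite column parity `T` is `±q`. -/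
theorem adjClosed_Mon_two (δ : VanCycle 2 d) : AdjClosed ℂ 2 d (Mon ℂ δ) := by
  have hp : rowEnd ℂ 2 d = 0 := by
    rw [rowEnd, rowAdj, pathAdj_two, Matrix.zero_kronecker, map_zero]
  intro v hv c c' _ hc' _ ht
  have h1 : varEnd ℂ 2 d v = c' • colEnd ℂ 2 d v := by
    rw [varEnd, IsGrid.gridVar_apply, ht, hp]
    simp
  have h2 := varEnd_mem_Mon ℂ δ v hv
  rw [h1] at h2
  refine ⟨by rw [hp]; exact Submodule.zero_mem _, ?_⟩
  rwa [Submodule.smul_mem_iff] at h2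
  rcases hc' with rfl | rfl <;> simp

theorem adjClosed_Mon_three (h3 : ¬ 3 ∣ d) (δ : VanCycle 3 d) : AdjClosed ℂ 3 d (Mon ℂ δ) := by
  have hsq : ∀ v : VanCycle 3 d → ℂ, rowEnd ℂ 3 d (rowEnd ℂ 3 d v) = (1 : ℂ) • v :=
    rowEnd_apply_of_sq (by rw [pathAdj_three_sq, one_smul])
  refine adjClosed_Mon (x₀ := 1) (fun v => hsq _) (IsCosSq.ne_one h3) ?_ δ
  intro x y x' y' l v v' hv hv' hx hx' hy hy' hl hl'
  rw [hsq] at hx hx'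
  obtain rfl := smul_left_injective ℂ hv hx
  obtain rfl := smul_left_injective ℂ hv' hx'
  refine ⟨rfl, IsCosSq.eq_of_relation_one h3 hy hy' (l := l) ?_ ?_⟩
  · linear_combination hl
  · linear_combination hl'

theorem adjClosed_Mon_four (h4 : ¬ 4 ∣ d) (δ : VanCycle 4 d) : AdjClosed ℂ 4 d (Mon ℂ δ) := by
  have hcube : ∀ v : VanCycle 4 d → ℂ,
      rowEnd ℂ 4 d (rowEnd ℂ 4 d (rowEnd ℂ 4 d v)) = (2 : ℂ) • rowEnd ℂ 4 d v :=
    rowEnd_apply_of_cube (pathAdj_four_cube ℂ)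
  have hx2 : ∀ (x : ℂ) (v : VanCycle 4 d → ℂ), v ≠ 0 →
      rowEnd ℂ 4 d (rowEnd ℂ 4 d v) = x • v → x = 0 ∨ x = 2 := by
    intro x v hv h
    have h1 := hcube (rowEnd ℂ 4 d v)
    rw [h, map_smul, map_smul, h, smul_smul, smul_smul] at h1
    have := smul_left_injective ℂ hv h1
    have h2 : x * (x - 2) = 0 := by linear_combination this
    rcases mul_eq_zero.1 h2 with h | h
    · exact Or.inl h
    · exact Or.inr (sub_eq_zero.1 h)
  refine adjClosed_Mon (x₀ := 2) hcube (IsCosSq.ne_two h4) ?_ δ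
  intro x y x' y' l v v' hv hv' hx hx' hy hy' hl hl'
  have sq0 : ∀ {a b : ℂ}, (a - b) ^ 2 = 0 → a = b := fun h =>
    sub_eq_zero.1 (pow_eq_zero_iff two_ne_zero |>.1 h)
  -- The eigenvalues of `p²` are `0` and `2`. For `x = 0` the relation degenerates to `(l - y)² =
  -- 0`; the mixed cases are excluded by `IsCosSq.relation_zero_two`.
  rcases hx2 x v hv hx with rfl | rfl <;> rcases hx2 x' v' hv' hx' with rfl | rfl
  · have e1 : l = y := sq0 (by linear_combination hl)
    have e2 : l = y' := sq0 (by linear_combination hl')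
    exact ⟨rfl, e1 ▸ e2⟩
  · obtain rfl : l = y := sq0 (by linear_combination hl)
    exact absurd hl' (IsCosSq.relation_zero_two h4 hy' hy)
  · obtain rfl : l = y' := sq0 (by linear_combination hl')
    exact absurd hl (IsCosSq.relation_zero_two h4 hy hy')
  · exact ⟨rfl, IsCosSq.eq_of_relation_two h4 hy hy' hl hl'⟩

end

/-! ### A multiple eigenvalue when `e ∣ d`. -/

namespace IsGrid
variable {K : Type*} [Field K] [CharZero K] {V : Type*} [AddCommGroup V] [Module K V]
  {p q s t : Module.End K V} (h : IsGrid p q s t)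
include h

omit [CharZero K] in
lemma sign_rules (z : V) : p (s z) = -s (p z) ∧ p (t z) = t (p z) ∧ q (s z) = s (q z) ∧
    q (t z) = -t (q z) ∧ s (s z) = z ∧ t (t z) = z ∧ t (s z) = s (t z) := by
  obtain ⟨-, h2, h3, h4, h5⟩ := h.apply_rules z
  exact ⟨by rw [h2, neg_neg], h4.symm, h3.symm, by rw [h5, neg_neg], LinearMap.congr_fun h.ss z,
    LinearMap.congr_fun h.tt z, LinearMap.congr_fun h.ts z⟩

omit [CharZero K] in
-- `T` sends `s z` and `t z` to the same vector.
lemma gridVar_apply_sub {z : V} {x : K} (hp : p z = x • z) (hq : q z = x • z) :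
    gridVar K p q s t (s z - t z) = 0 := by
  rw [IsGrid.gridVar_apply]
  simp only [map_sub, map_neg, map_smul, h.sign_rules, hp, hq]
  module

/-- `T` sends `z + s t z` to `x² (s z + t z)` and `z - s t z` to `-2x (s z + t z)`, whence the
coefficient `x / 2`. -/
lemma gridVar_apply_add {z : V} {x : K} (hp : p z = x • z) (hq : q z = x • z) :
    gridVar K p q s t (z + s (t z) + (x / 2) • (z - s (t z))) = 0 := by
  rw [IsGrid.gridVar_apply]
  simp only [map_sub, map_add, map_neg, map_smul, h.sign_rules, hp, hq]
  module

end IsGrid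

/-- An eigenvalue of multiplicity at least two lowers the number of eigenvalues. -/
lemma Matrix.ncard_spectrum_lt {n : Type*} [Fintype n] [DecidableEq n] {A : Matrix n n ℂ} {μ : ℂ}
    {v w : n → ℂ} (hv : A.mulVec v = μ • v) (hw : A.mulVec w = μ • w)
    (h : LinearIndependent ℂ ![v, w]) : (spectrum ℂ A).ncard < Fintype.card n := by
  have hspec : spectrum ℂ A = (A.charpoly.roots.toFinset : Set ℂ) := by
    ext z
    rw [Matrix.mem_spectrum_iff_isRoot_charpoly, Finset.mem_coe, Multiset.mem_toFinset,
      Polynomial.mem_roots A.charpoly_monic.ne_zero]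
  have hmult : 2 ≤ A.charpoly.roots.count μ := by
    rw [Polynomial.count_roots, ← Matrix.charpoly_toLin']
    refine le_trans ?_ (LinearMap.finrank_eigenspace_le (Matrix.toLin' A) μ)
    have hm : ∀ i, ![v, w] i ∈ Module.End.eigenspace (Matrix.toLin' A) μ := by
      intro i
      rw [Module.End.mem_eigenspace_iff, Matrix.toLin'_apply]
      fin_cases i
      exacts [hv, hw]
    have h' : LinearIndependent ℂ fun i => (⟨![v, w] i, hm i⟩ : Module.End.eigenspace (Matrix.toLin' A) μ) :=
      LinearIndependent.of_comp (Submodule.subtype _) h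
    simpa using h'.fintype_card_le_finrank
  have hlt : A.charpoly.roots.toFinset.card < Multiset.card A.charpoly.roots := by
    refine lt_of_le_of_ne (Multiset.toFinset_card_le _) fun e => ?_
    have := Multiset.nodup_iff_count_le_one.1 (Multiset.toFinset_card_eq_card_iff_nodup.1 e) μ
    omega
  rw [hspec, Set.ncard_coe_finset]
  exact hlt.trans_le ((Polynomial.card_roots' _).trans_eq A.charpoly_natDegree_eq_dim)

theorem ncard_spectrum_lt_of_dvd {e d : ℕ} (he : 3 ≤ e) (hd : 1 ≤ d) (h : e ∣ d) :
    (spectrum ℂ (monodromyMatrix ℂ e d)).ncard < (e - 1) * (d - 1) := by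
  have hed := Nat.le_of_dvd hd h
  -- As `e ∣ d`, the function `sin(k α)` vanishes at both `e` and `d`, so it is an eigenvector of
  -- both paths for the same eigenvalue.
  set α : ℂ := Real.pi / e with hα
  have e0 : (e : ℂ) ≠ 0 := Nat.cast_ne_zero.2 (by omega)
  have he' : Complex.sin (e * α) = 0 := by
    rw [hα, mul_div_cancel₀ _ e0, Complex.sin_pi]
  have hd' : Complex.sin (d * α) = 0 := by
    obtain ⟨c, rfl⟩ := h
    rw [hα, Nat.cast_mul, mul_comm (e : ℂ), mul_assoc, mul_div_cancel₀ _ e0, Complex.sin_nat_mul_pi]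
  have sne : ∀ k : ℕ, 1 ≤ k → k < e → Complex.sin (k * α) ≠ 0 := by
    intro k hk hke
    have e0' : (0 : ℝ) < e := Nat.cast_pos.2 (by omega)
    have hpos : 0 < Real.sin (k * (Real.pi / e)) := by
      apply Real.sin_pos_of_pos_of_lt_pi
      · exact mul_pos (Nat.cast_pos.2 hk) (div_pos Real.pi_pos e0')
      · rw [← mul_div_assoc, div_lt_iff₀ e0', mul_comm]
        exact mul_lt_mul_of_pos_left (Nat.cast_lt.2 hke) Real.pi_pos
    have : Complex.sin (k * α) = (Real.sin (k * (Real.pi / e)) : ℝ) := by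
      rw [hα]; push_cast; rfl
    rw [this]
    exact Complex.ofReal_ne_zero.2 hpos.ne'
  set z : VanCycle e d → ℂ := gridTensor (fun k => Complex.sin ((k : ℕ) * α))
    (fun k => Complex.sin ((k : ℕ) * α)) with hz
  have smulT : ∀ (c : ℂ) (u : Finset.Ico 1 e → ℂ) (w : Finset.Ico 1 d → ℂ),
      (gridTensor (c • u) w : VanCycle e d → ℂ) = c • gridTensor u w ∧
      (gridTensor u (c • w) : VanCycle e d → ℂ) = c • gridTensor u w := by
    intro c u w
    constructor <;> ext δ <;> simp only [gridTensor, Pi.smul_apply, smul_eq_mul] <;> ring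
  have hp : rowEnd ℂ e d z = (2 * Complex.cos α) • z := by
    rw [rowEnd, Matrix.toLinAlgEquiv'_apply, hz, rowAdj_mulVec_gridTensor, pathAdj_mulVec_sin he',
      (smulT _ _ _).1]
  have hq : colEnd ℂ e d z = (2 * Complex.cos α) • z := by
    rw [colEnd, Matrix.toLinAlgEquiv'_apply, hz, colAdj_mulVec_gridTensor, pathAdj_mulVec_sin hd',
      (smulT _ _ _).2]
  have k1 := (isGrid_end ℂ e d).gridVar_apply_sub hp hq
  have k2 := (isGrid_end ℂ e d).gridVar_apply_add hp hq
  rw [← card_vanCycle]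
  refine Matrix.ncard_spectrum_lt (μ := 1)
    (v := rowSgn ℂ e d z - colSgn ℂ e d z)
    (w := z + rowSgn ℂ e d (colSgn ℂ e d z) +
      (2 * Complex.cos α / 2) • (z - rowSgn ℂ e d (colSgn ℂ e d z))) ?_ ?_ ?_
  · rw [monodromyMatrix_mulVec, varEnd, k1, add_zero, one_smul]
  · rw [monodromyMatrix_mulVec, varEnd, k2, add_zero, one_smul]
  · rw [LinearIndependent.pair_iff]
    intro a b hab
    -- At `δ₁` the parities agree, so the first vector vanishes and the second equals `2 z`; at `δ₂`
    -- they differ and the first equals `2 z`. The second row exists because `e ≥ 3`.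
    set δ₁ : VanCycle e d := (⟨1, Finset.mem_Ico.2 ⟨le_rfl, by omega⟩⟩,
      ⟨1, Finset.mem_Ico.2 ⟨le_rfl, by omega⟩⟩) with hδ₁
    set δ₂ : VanCycle e d := (⟨2, Finset.mem_Ico.2 ⟨by omega, by omega⟩⟩,
      ⟨1, Finset.mem_Ico.2 ⟨le_rfl, by omega⟩⟩) with hδ₂
    have row1 : δ₁.row = 1 := rfl
    have row2 : δ₂.row = 2 := rfl
    have col1 : δ₁.col = 1 := rfl
    have col2 : δ₂.col = 1 := rfl
    have z1 : z δ₁ ≠ 0 := mul_ne_zero (sne 1 le_rfl (by omega)) (sne 1 le_rfl (by omega))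
    have z2 : z δ₂ ≠ 0 := mul_ne_zero (sne 2 (by omega) (by omega)) (sne 1 le_rfl (by omega))
    have h1 := congrFun hab δ₁
    have h2 := congrFun hab δ₂
    simp only [rowSgn, colSgn, Matrix.toLinAlgEquiv'_apply, Pi.add_apply, Pi.smul_apply,
      Pi.sub_apply, rowSign_mulVec, colSign_mulVec, row1, row2, col1, col2, smul_eq_mul,
      Pi.zero_apply] at h1 h2
    have hb : b = 0 := by
      have : b * z δ₁ = 0 := by linear_combination h1 / 2
      exact (mul_eq_zero.1 this).resolve_right z1
    rw [hb] at h2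
    have : a * z δ₂ = 0 := by linear_combination h2 / 2
    exact ⟨(mul_eq_zero.1 this).resolve_right z2, hb⟩

/-! ### Eigenvalues for `e = 2`. -/

/-- The eigenvalues of the monodromy of `y ^ 2 + x ^ d`. -/
theorem spectrum_monodromyMatrix_two (d : ℕ) :
    spectrum ℂ (monodromyMatrix ℂ 2 d) =
      {z : ℂ | ∃ j : ℕ, 1 ≤ j ∧ j ≤ d - 1 ∧
        z = 1 + 2 * Complex.I * ((Real.cos (j * Real.pi / d) : ℝ) : ℂ)} := by
  have hp : rowEnd ℂ 2 d = 0 := by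
    rw [rowEnd, rowAdj, pathAdj_two, Matrix.zero_kronecker, map_zero]
  have h := isGrid_end ℂ 2 d
  have hM : ∀ v, (monodromyMatrix ℂ 2 d).mulVec v = v + colEnd ℂ 2 d (colSgn ℂ 2 d v) := by
    intro v
    rw [monodromyMatrix_mulVec, varEnd, IsGrid.gridVar_apply, hp]
    simp
  have I2 := Complex.I_mul_I
  have cosd : ∀ j : ℕ, 1 ≤ j → j ≤ d - 1 →
      Complex.cos ((d - j : ℕ) * Real.pi / d) = -Complex.cos (j * Real.pi / d) := by
    intro j hj hjd
    have d0 : (d : ℂ) ≠ 0 := Nat.cast_ne_zero.2 (by omega)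
    rw [← Complex.cos_pi_sub, Nat.cast_sub (by omega)]
    congr 1
    field_simp
  ext l
  rw [← Matrix.spectrum_toLin', ← Module.End.hasEigenvalue_iff_mem_spectrum]
  constructor
  · intro hl
    obtain ⟨v, hv, v0⟩ := hl.exists_hasEigenvector
    rw [Module.End.mem_eigenspace_iff, Matrix.toLin'_apply, hM] at hv
    have hv' : colEnd ℂ 2 d (colSgn ℂ 2 d v) = (l - 1) • v := by
      rw [sub_smul, one_smul, ← hv, add_sub_cancel_left]
    have hv'' : colEnd ℂ 2 d v = -((l - 1) • colSgn ℂ 2 d v) := by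
      have := (h.sign_rules (colSgn ℂ 2 d v)).2.2.2.1
      rwa [(h.sign_rules v).2.2.2.2.2.1, hv', map_smul] at this
    -- The combination `v + i t v` turns an eigenvector of `q t` for `l - 1` into an eigenvector of
    -- `q` for `i (l - 1)`.
    have w0 : v + Complex.I • colSgn ℂ 2 d v ≠ 0 := by
      intro e
      have e2 : colSgn ℂ 2 d (v + Complex.I • colSgn ℂ 2 d v) = 0 := by rw [e, map_zero]
      rw [map_add, map_smul, (h.sign_rules v).2.2.2.2.2.1] at e2
      have : (2 : ℂ) • v = (v + Complex.I • colSgn ℂ 2 d v) -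
          Complex.I • (colSgn ℂ 2 d v + Complex.I • v) := by
        rw [smul_add, smul_smul, I2]; module
      rw [e, e2, smul_zero, sub_zero] at this
      exact v0 ((smul_eq_zero.1 this).resolve_left two_ne_zero)
    obtain ⟨k, hk, hkd, hc⟩ := exists_cos_of_colEnd w0 (y := Complex.I * (l - 1)) (by
      rw [map_add, map_smul, hv', hv'', smul_add, smul_smul, smul_smul,
        show Complex.I * (l - 1) * Complex.I = (l - 1) * (Complex.I * Complex.I) by ring, I2]
      module)
    -- Solving for `l` gives `1 - 2i cos(kπ/d)`; replacing `k` by `d - k` absorbs the sign.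
    refine ⟨d - k, by omega, by omega, ?_⟩
    push_cast
    rw [cosd k hk hkd]
    linear_combination -Complex.I * hc + (l - 1) * I2
  · rintro ⟨j, hj, hjd, rfl⟩
    push_cast
    have d0 : (d : ℂ) ≠ 0 := Nat.cast_ne_zero.2 (by omega)
    set α : ℂ := (d - j : ℕ) * Real.pi / d with hα
    have hs : Complex.sin (d * α) = 0 := by
      rw [hα, mul_div_cancel₀ _ d0, Complex.sin_nat_mul_pi]
    have hs1 : Complex.sin α ≠ 0 := by
      have d0' : (0 : ℝ) < d := Nat.cast_pos.2 (by omega)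
      have hpos : 0 < Real.sin ((d - j : ℕ) * Real.pi / d) := by
        apply Real.sin_pos_of_pos_of_lt_pi
        · exact div_pos (mul_pos (Nat.cast_pos.2 (by omega)) Real.pi_pos) d0'
        · rw [div_lt_iff₀ d0', mul_comm]
          exact mul_lt_mul_of_pos_left (Nat.cast_lt.2 (by omega)) Real.pi_pos
      have : Complex.sin α = (Real.sin ((d - j : ℕ) * Real.pi / d) : ℝ) := by
        rw [hα]; push_cast; rfl
      rw [this]
      exact Complex.ofReal_ne_zero.2 hpos.ne'
    set w : VanCycle 2 d → ℂ := gridTensor (fun _ => 1) (fun k => Complex.sin ((k : ℕ) * α)) with hw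
    have hq : colEnd ℂ 2 d w = (2 * Complex.cos α) • w := by
      rw [colEnd, Matrix.toLinAlgEquiv'_apply, hw, colAdj_mulVec_gridTensor, pathAdj_mulVec_sin hs]
      ext δ
      simp only [gridTensor, Pi.smul_apply, smul_eq_mul]
      ring
    have w0 : w ≠ 0 := by
      intro e
      have := congrFun e (⟨1, by decide⟩, ⟨1, Finset.mem_Ico.2 ⟨le_rfl, by omega⟩⟩)
      simp [hw, gridTensor] at this
      exact hs1 this
    have hc := cosd j hj hjd
    rw [← hα, eq_comm, neg_eq_iff_eq_neg] at hc
    refine Module.End.hasEigenvalue_of_hasEigenvector (x := w - Complex.I • colSgn ℂ 2 d w) ⟨?_, ?_⟩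
    · rw [Module.End.mem_eigenspace_iff, Matrix.toLin'_apply, hM]
      simp only [map_sub, map_smul, h.sign_rules, hq]
      rw [hc]
      match_scalars
      · ring
      · linear_combination -(2 * Complex.cos α) * I2
    · intro e
      have e2 : colSgn ℂ 2 d (w - Complex.I • colSgn ℂ 2 d w) = 0 := by rw [e, map_zero]
      rw [map_sub, map_smul, (h.sign_rules w).2.2.2.2.2.1] at e2
      have : (2 : ℂ) • w = (w - Complex.I • colSgn ℂ 2 d w) +
          Complex.I • (colSgn ℂ 2 d w - Complex.I • w) := by
        rw [smul_sub, smul_smul, I2]; module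
      rw [e, e2, smul_zero, add_zero] at this
      exact w0 ((smul_eq_zero.1 this).resolve_left two_ne_zero)

/-! ### Descent from `ℂ` to `K`. -/

/-- Membership in the span of integer vectors does not depend on the field of characteristic `0`. -/
lemma mem_span_range_intCast {K L : Type*} [Field K] [CharZero K] [Field L] [CharZero L]
    {ι n : Type*} [Finite ι] {u : ι → n → ℤ} {w : n → ℤ}
    (h : (fun x => (w x : L)) ∈ Submodule.span L (Set.range fun i x => (u i x : L))) :
    (fun x => (w x : K)) ∈ Submodule.span K (Set.range fun i x => (u i x : K)) := by
  have := Fintype.ofFinite ι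
  rw [Submodule.mem_span_range_iff_exists_fun] at h ⊢
  obtain ⟨c, hc⟩ := h
  -- A `ℚ`-linear retraction `L → ℚ` applied to the coefficients turns a relation over `L` between
  -- integer vectors into a rational one, which can be read in `K`.
  obtain ⟨π, hπ⟩ := (Algebra.linearMap ℚ L).exists_leftInverse_of_injective
    (LinearMap.ker_eq_bot.2 (algebraMap ℚ L).injective)
  refine ⟨fun i => ((π (c i) : ℚ) : K), ?_⟩
  ext x
  have h1 := congrArg π (congrFun hc x)
  have h2 : π (w x : L) = w x := by
    have := LinearMap.congr_fun hπ (w x : ℚ)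
    simpa using this
  rw [h2, Finset.sum_apply, map_sum] at h1
  have h3 : ∀ i, π ((c i • fun x => (u i x : L)) x) = π (c i) * u i x := by
    intro i
    rw [Pi.smul_apply, smul_eq_mul, mul_comm, ← zsmul_eq_mul, map_zsmul, zsmul_eq_mul, mul_comm]
  simp only [h3] at h1
  rw [Finset.sum_apply]
  simp only [Pi.smul_apply, smul_eq_mul]
  exact_mod_cast congrArg (Rat.cast : ℚ → K) h1

section
variable (K : Type*) [Field K] {e d : ℕ}

lemma Mon_eq_span_range (δ : VanCycle e d) :
    Mon K δ = Submodule.span K (Set.range fun (l : Fin ((e - 1) * (d - 1))) x =>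
      ((((1 - intersectionMatrix e d) ^ (l : ℕ)).mulVec (Pi.single δ 1) x : ℤ) : K)) := by
  have key : ∀ l : ℕ, (monodromyMatrix K e d ^ l).mulVec (cycleVec K δ) =
      fun x => ((((1 - intersectionMatrix e d) ^ l).mulVec (Pi.single δ 1) x : ℤ) : K) := by
    intro l
    ext x
    have h1 : monodromyMatrix K e d =
        (Int.castRingHom K).mapMatrix (1 - intersectionMatrix e d) := by
      rw [map_sub, map_one]; rfl
    have h2 : cycleVec K δ = Int.castRingHom K ∘ (Pi.single δ 1) := by
      ext y
      simp only [cycleVec, Function.comp_apply, Pi.single_apply]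
      split_ifs <;> simp
    have := RingHom.map_mulVec (Int.castRingHom K) ((1 - intersectionMatrix e d) ^ l)
      (Pi.single δ 1) x
    rw [h1, ← map_pow, h2]
    exact this.symm
  rw [Mon]
  congr 1
  ext v
  constructor
  · rintro ⟨l, hl, rfl⟩
    exact ⟨⟨l, hl⟩, (key l).symm⟩
  · rintro ⟨l, rfl⟩
    exact ⟨l, l.2, (key l).symm⟩

variable {K}

theorem cycleVec_mem_Mon_of_complex [CharZero K] {δ δ' : VanCycle e d}
    (h : cycleVec ℂ δ' ∈ Mon ℂ δ) : cycleVec K δ' ∈ Mon K δ := by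
  have hc : cycleVec K δ' = fun x => (((Pi.single δ' 1 : _ → ℤ) x : ℤ) : K) := by
    ext y
    simp only [cycleVec, Pi.single_apply]
    split_ifs <;> simp
  have hc' : cycleVec ℂ δ' = fun x => (((Pi.single δ' 1 : _ → ℤ) x : ℤ) : ℂ) := by
    ext y
    simp only [cycleVec, Pi.single_apply]
    split_ifs <;> simp
  rw [Mon_eq_span_range, hc'] at h
  rw [Mon_eq_span_range, hc]
  exact mem_span_range_intCast h

end

/-! ### The columns as multiples of the gcd, and the conclusion. -/

lemma exists_mul_iff_dvd {d r l : ℕ} (hr : r ∣ d) (h1 : 1 ≤ l) (h2 : l < d) :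
    (∃ n : ℕ, 1 ≤ n ∧ n ≤ d / r - 1 ∧ l = r * n) ↔ r ∣ l := by
  obtain ⟨c, rfl⟩ := hr
  constructor
  · rintro ⟨n, -, -, rfl⟩
    exact dvd_mul_right r n
  · rintro ⟨n, rfl⟩
    have hr : 0 < r := Nat.pos_of_ne_zero (by rintro rfl; simp at h1)
    rw [Nat.mul_div_cancel_left _ hr]
    have hn : n < c := lt_of_mul_lt_mul_left h2 (Nat.zero_le r)
    have : n ≠ 0 := by rintro rfl; simp at h1
    exact ⟨n, by omega, by omega, rfl⟩

theorem cycleVec_mem_Mon_iff {K : Type*} [Field K] [CharZero K] {e d : ℕ} {δ δ' : VanCycle e d}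
    (hS : AdjClosed ℂ e d (Mon ℂ δ)) (hrow : Nat.gcd e δ.row ∣ δ'.row) :
    cycleVec K δ' ∈ Mon K δ ↔
      ∃ n : ℕ, 1 ≤ n ∧ n ≤ d / Nat.gcd d δ.col - 1 ∧ δ'.col = Nat.gcd d δ.col * n := by
  have : 1 ≤ δ'.col ∧ δ'.col < d := Finset.mem_Ico.1 δ'.2.2
  rw [exists_mul_iff_dvd (Nat.gcd_dvd_left d δ.col) this.1 this.2]
  exact ⟨gcd_dvd_col_of_mem_Mon K, fun hcol =>
    cycleVec_mem_Mon_of_complex (hS.cycleVec_mem (cycleVec_mem_Mon ℂ δ) hrow hcol)⟩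

lemma gcd_three_row {d : ℕ} (δ δ' : VanCycle 3 d) : Nat.gcd 3 δ.row ∣ δ'.row := by
  have h : 1 ≤ δ.row ∧ δ.row < 3 := Finset.mem_Ico.1 δ.1.2
  obtain ⟨h1, h2⟩ := h
  interval_cases δ.row <;> simp

theorem mainTheorem7 (K : Type*) [Field K] [CharZero K] (d : ℕ) (hd : 1 ≤ d) :
    -- `y^2 + x^d`, every degree `d`: the eigenvalues of `M_2`, and the cycles in `Mon(δ_1^j)`
    (spectrum ℂ (monodromyMatrix ℂ 2 d) =
        {z : ℂ | ∃ j : ℕ, 1 ≤ j ∧ j ≤ d - 1 ∧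
          z = 1 + 2 * Complex.I * ((Real.cos (j * Real.pi / d) : ℝ) : ℂ)} ∧
      ∀ δ δ' : VanCycle 2 d,
        cycleVec K δ' ∈ Mon K δ ↔
          ∃ n : ℕ, 1 ≤ n ∧ n ≤ d / Nat.gcd d δ.col - 1 ∧ δ'.col = Nat.gcd d δ.col * n) ∧
    -- `y^3 + x^d`
    (d ≤ 100 → ¬ 3 ∣ d → ∀ δ δ' : VanCycle 3 d,
        cycleVec K δ' ∈ Mon K δ ↔
          ∃ n : ℕ, 1 ≤ n ∧ n ≤ d / Nat.gcd d δ.col - 1 ∧ δ'.col = Nat.gcd d δ.col * n) ∧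
    (3 ∣ d → (spectrum ℂ (monodromyMatrix ℂ 3 d)).ncard < 2 * (d - 1)) ∧
    -- `y^4 + x^d`
    (d ≤ 100 → ¬ 4 ∣ d → ∀ δ δ' : VanCycle 4 d,
        ((δ.row = 1 ∨ δ.row = 3) →
          (cycleVec K δ' ∈ Mon K δ ↔
            ∃ n : ℕ, 1 ≤ n ∧ n ≤ d / Nat.gcd d δ.col - 1 ∧ δ'.col = Nat.gcd d δ.col * n)) ∧
        (δ.row = 2 →
          (cycleVec K δ' ∈ Mon K δ ↔
            δ'.row = 2 ∧
              ∃ n : ℕ, 1 ≤ n ∧ n ≤ d / Nat.gcd d δ.col - 1 ∧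
                δ'.col = Nat.gcd d δ.col * n))) ∧
    (4 ∣ d → (spectrum ℂ (monodromyMatrix ℂ 4 d)).ncard < 3 * (d - 1)) := by
  refine ⟨⟨spectrum_monodromyMatrix_two d, fun δ δ' => ?_⟩, fun _ h3 δ δ' => ?_, fun h3 => ?_,
    fun _ h4 δ δ' => ⟨fun hδ => ?_, fun hδ => ?_⟩, fun h4 => ?_⟩
  · refine cycleVec_mem_Mon_iff (adjClosed_Mon_two δ) ?_
    have h : 1 ≤ δ.row ∧ δ.row < 2 := Finset.mem_Ico.1 δ.1.2
    rw [show δ.row = 1 by omega]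
    exact one_dvd _
  · exact cycleVec_mem_Mon_iff (adjClosed_Mon_three h3 δ) (gcd_three_row δ δ')
  · exact ncard_spectrum_lt_of_dvd le_rfl hd h3
  · refine cycleVec_mem_Mon_iff (adjClosed_Mon_four h4 δ) ?_
    rcases hδ with h | h <;> rw [h] <;> exact one_dvd _
  · have iff := fun h : δ'.row = 2 => cycleVec_mem_Mon_iff (K := K) (δ' := δ') (adjClosed_Mon_four h4 δ)
      (by rw [hδ, h]; exact dvd_rfl)
    exact ⟨fun h => ⟨row_eq_two_of_mem_Mon K hδ h, (iff (row_eq_two_of_mem_Mon K hδ h)).1 h⟩,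
      fun h => (iff h.1).2 h.2⟩
  · exact ncard_spectrum_lt_of_dvd (by norm_num) hd h4
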